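/- **Setting.** Let $\mathscr L$ and $\mathscr H$ be real Hilbert spaces and $\tilde{\mathscr H}$ a real inner product space, with $\tilde{\mathscr H}\subset\mathscr H\subset\mathscr L$ and $\|\cdot\|_{\mathscr L}\le\|\cdot\|_{\mathscr H}$ on $\mathscr H$, $\|\cdot\|_{\mathscr H}\le\|\cdot\|_{\tilde{\mathscr H}}$ on $\tilde{\mathscr H}$. Let $\mathcal E:\mathscr L\to(-\infty,+\infty]$, let $\mathscr F^\pm\subset\mathscr L$ be nonempty, and put $\mathscr F^\pm_\rho=\{v\in\mathscr L:\mathrm{dist}_{\mathscr L}(v,\mathscr F^\pm)\le\rho\}$, $\mathscr F^\pm_{\mathscr H,\rho}=\{v\in\mathscr H:\mathrm{dist}_{\mathscr H}(v,\mathscr F^\pm)\le\rho\}$. Let $a<0$, $\ell^-=a$, $\ell^+=0$ (so $\ell^\pm=\min\{\pm(-a),0\}$), and let $r_0^\pm>0$, $C^\pm>1$ be constants. Assume: 1. $\mathcal E$ is (sequentially) weakly lower semicontinuous; $\mathscr F^\pm$ are closed in $\mathscr L$; $\mathcal E\ge a$ on $\mathscr L$ and $\mathcal E=a$ on $\mathscr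 F^-$; each element of $\mathscr F^+$ is a local minimizer of $\mathcal E$ in $\mathscr L$ with $\mathcal E=0$; $\mathscr F^+_{r_0^+}\cap\mathscr F^-_{r_0^-}=\emptyset$; $(C^\pm)^{-1}\mathrm{dist}_{\mathscr L}(v,\mathscr F^\pm)^2\le\mathcal E(v)-\ell^\pm$ for $v\in\mathscr F^\pm_{r_0^\pm}$; each $v\in\mathscr F^\pm_{r_0^\pm}$ has a unique $\mathscr L$-nearest point $P^\pm(v)$ in $\mathscr F^\pm$, and $P^\pm$ is $C^2$ on $\mathscr F^\pm_{r_0^\pm}$ for the $\mathscr L$-norm. 2. $\mathscr H=\{\mathcal E<+\infty\}$; $\mathcal E$ is $C^1$ on $(\mathscr H,\|\cdot\|_{\mathscr H})$; there is a continuous map $D_{\mathscr L}\mathcal E:\tilde{\mathscr H}\to\mathscr L$ with $\langle D_{\mathscr L}\mathcal E(v),w\rangle_{\mathscr L}=D\mathcal E(v)(w)$ for all $v\in\tilde{\mathscr H}$, $w\in\mathscr H$. 3. $\mathscr L$-bounded subsets of $\mathscr F^\pm$ are relatively compact in $\mathscr H$. 4. For each sign, either $\mathscr F^\pm$ is $\mathscr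 L$-bounded, or for all $v\in\mathscr F^\pm_{r_0^\pm}$ and $\mathbf v\in\mathscr F^\pm$ there is a differentiable $\hat P:\mathscr L\to\mathscr L$ with $P^\pm(\hat P(v))=\mathbf v$, $\mathrm{dist}_{\mathscr L}(\hat P(v),\mathscr F^\pm)=\mathrm{dist}_{\mathscr L}(v,\mathscr F^\pm)$, $\mathcal E(\hat P(v))=\mathcal E(v)$, and $\|D\hat P(w_1)w_2\|_{\mathscr L}=\|w_2\|_{\mathscr L}$ for all $w_1,w_2\in\mathscr L$. 5. Each $v\in\mathscr F^\pm_{\mathscr H,r_0^\pm}$ has a unique $\mathscr H$-nearest point $P^\pm_{\mathscr H}(v)$ in $\mathscr F^\pm$; $P^\pm_{\mathscr H}$ is $C^1$ for the $\mathscr H$-norm; and for these $v$, $\|P^\pm(v)-P^\pm_{\mathscr H}(v)\|_{\mathscr H}\le C^\pm\|v-P^\pm_{\mathscr H}(v)\|_{\mathscr H}$ and $(C^\pm)^{-2}\|v-P^\pm_{\mathscr H}(v)\|^2_{\mathscr H}\le\mathcal E(v)-\ell^\pm\le(C^\pm)^2\|v-P^\pm_{\mathscr H}(v)\|^2_{\mathscr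 H}$. For $\rho\in(0,r_0^\pm]$ there are $\beta^\pm(\rho)>0$ such that $v\in\mathscr F^\pm_{r_0^\pm}$ and $\mathcal E(v)\le\ell^\pm+\beta^\pm(\rho)$ imply $v\in\mathscr F^\pm_{\mathscr H,\rho}$. 6. For $c>0$ and an interval $I$ let $\mathbf E_c(U;I)=\int_I\big[\tfrac12\|U'(t)\|_{\mathscr L}^2+\mathcal E(U(t))\big]e^{ct}\,dt$ and $\mathbf E_c(U)=\mathbf E_c(U;\mathbb R)$. For open $O\subset\mathbb R$ let $\mathcal A(O)=C^2(O,\mathscr L)\cap C^1(O,\mathscr H)\cap C^0(O,\tilde{\mathscr H})$. There is $\mathfrak P:\mathscr L\to\mathscr L$, $1$-Lipschitz, equal to the identity on $\mathscr F^\pm$, with $\mathcal E(\mathfrak P(v))\le\mathcal E(v)$ for all $v$, where, if $\mathcal E(v)<+\infty$, equality holds if and only if $\mathfrak P(v)=v$. If $I$ is a nonempty bounded open interval, $c>0$, and $W\in H^1_{\rm loc}(I,\mathscr L)$ satisfies $W=\mathfrak P(W)$ on $I$ and is a local minimizer of $\mathbf E_c(\cdot;I)$ (that is, $\mathbf E_c(W;I)$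 is well defined and finite, and for some $\varepsilon>0$, $\mathbf E_c(W+\phi;I)$ is well defined and at least $\mathbf E_c(W;I)$ for all $\phi\in C^1_c(I,\mathscr H)$ with $\max\|\phi\|_{\mathscr H}<\varepsilon$), then $W\in\mathcal A(I)$ and $W''-D_{\mathscr L}\mathcal E(W)=-cW'$ in $I$. **Constants.** Let $\kappa^-_\rho=\inf\{\mathcal E(v):\mathrm{dist}_{\mathscr L}(v,\mathscr F^-)\in[\rho,r_0^-]\}$, $\eta_0^-=\min\Big\{\sqrt{e^{-1}\tfrac{r_0^-}4\sqrt{2(\kappa^-_{r_0^- /4}-a)}},\tfrac{r_0^-}4\Big\}$, $\hat r^-=\frac{r_0^-}{C^-+1}$, $$\mathcal E_{\max}^-=\frac{1}{(C^-)^2(C^-+1)}\min\Big\{\frac{(\eta_0^-)^2}4,\ \kappa^-_{\eta_0^-}-a,\ \beta^-(\hat r^-),\ \beta^-(\eta_0^-)\Big\},$$ $$\mathsf C^-=\tfrac12(C^-)^2\big((C^-)^2+(C^-+1)^2\big),\qquad \gamma^-=\frac1{C^-+\mathsf C^-},\qquad d_0=\mathrm{dist}_{\mathscr L}\big(\mathscr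 F^+_{r_0^+/2},\mathscr F^-_{r_0^- /2}\big).$$ Assume further: 7. $-a<\mathcal E_{\max}^-$ and $\{v\in\mathscr H:\mathcal E(v)<0\}\subset\mathscr F^-_{r_0^- /2}$. 8. $-a<\dfrac{(d_0\gamma^-)^2}{2}$. Let $X$ be the set of $U\in H^1_{\rm loc}(\mathbb R,\mathscr L)$ for which there is $T\ge1$ with $\mathrm{dist}_{\mathscr L}(U(t),\mathscr F^+)\le r_0^+/2$ for $t\ge T$ and $\mathrm{dist}_{\mathscr L}(U(t),\mathscr F^-)\le r_0^- /2$ for $t\le-T$. **Theorem.** Let $(c^\star,\mathbf U)$ be a solution as provided by the main abstract existence result: $c^\star>0$, $\mathbf U\in\mathcal A(\mathbb R)\cap X$, $\mathbf U''-D_{\mathscr L}\mathcal E(\mathbf U)=-c^\star\mathbf U'$ in $\mathbb R$, $\mathbf U$ is a global minimizer of $\mathbf E_{c^\star}$ in $X$ with $\mathbf E_{c^\star}(\mathbf U)=0$, and $\mathfrak P(\mathbf U(t))=\mathbf U(t)$ for all $t$. Then $c^\star<\gamma^-$, and there are $\mathbf v^-\in\mathscr F^-$ and $M^->0$ such that $$\|\mathbf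 U(t)-\mathbf v^-\|_{\mathscr L}\le M^-e^{(\gamma^--c^\star)t}\qquad\text{for all }t\in\mathbb R.$$ -/

import Mathlib

open Filter Topology MeasureTheory

noncomputable section

namespace TravelingWave

/-- The two signs used to index the objects carrying a superscript `±`. -/
inductive Sgn
  | minus
  | plus

/-- The sign as a real number. -/
def Sgn.val : Sgn → ℝ
  | .minus => -1
  | .plus => 1

/-- `U ∈ H¹_loc(O, L)` for `O ⊆ ℝ`, stated for the continuous representative: on every compact
interval in `O`, `U` is the integral of a square-integrable function. By Lebesgue's differentiation
theorem this function is `deriv U` almost everywhere. -/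
def H1loc {L : Type*} [NormedAddCommGroup L] [NormedSpace ℝ L] (O : Set ℝ) (U : ℝ → L) : Prop :=
  ∃ g : ℝ → L,
    (∀ s t : ℝ, Set.uIcc s t ⊆ O → MemLp g 2 (volume.restrict (Set.uIcc s t))) ∧
    (∀ s t : ℝ, Set.uIcc s t ⊆ O → U t - U s = ∫ x in s..t, g x)

/-- The objects of the abstract setting. The spaces `Ht ⊆ H ⊆ L` carry their own norms; the
inclusions are `incl : H → L` and `inclt : Ht → H`. The laws are in the hypotheses below. -/
structure Setting (L H Ht : Type*)
    [NormedAddCommGroup L] [InnerProductSpace ℝ L]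
    [NormedAddCommGroup H] [InnerProductSpace ℝ H]
    [NormedAddCommGroup Ht] [InnerProductSpace ℝ Ht] where
  /-- the potential, with values in `(-∞, +∞]` -/
  E : L → EReal
  /-- the minimum value of the potential -/
  a : ℝ
  /-- the two sets of minimizers -/
  F : Sgn → Set L
  /-- the radii `r₀^±` -/
  r : Sgn → ℝ
  /-- the constants `C^±` -/
  C : Sgn → ℝ
  /-- the projections onto `F^±` in the norm of `L`, relevant on the tubes of radius `r₀^±` -/
  P : Sgn → L → L
  /-- inclusion of `H` in `L` -/
  incl : H →L[ℝ] L
  /-- inclusion of `Ht` in `H` -/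
  inclt : Ht →L[ℝ] H
  /-- the `L`-gradient of the potential on `Ht` -/
  DL : Ht → L
  /-- the projections onto `F^±` in the norm of `H`, relevant on the `H`-tubes of radius `r₀^±` -/
  PH : Sgn → H → H
  /-- the constants `β^±(r)` -/
  beta : Sgn → ℝ → ℝ
  /-- the nonexpansive, energy-decreasing map of the regularity hypothesis -/
  proj : L → L

namespace Setting

variable {L H Ht : Type*}
  [NormedAddCommGroup L] [InnerProductSpace ℝ L]
  [NormedAddCommGroup H] [InnerProductSpace ℝ H]
  [NormedAddCommGroup Ht] [InnerProductSpace ℝ Ht]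
  (S : Setting L H Ht)

/-- `min {±(-a), 0}`, the value of the potential on `F^±`. -/
def level (s : Sgn) : ℝ := min (s.val * (-S.a)) 0

/-- `F^±_ρ`, the closed `ρ`-tube around `F^±` in `L`. -/
def tube (s : Sgn) (ρ : ℝ) : Set L := {v | Metric.infDist v (S.F s) ≤ ρ}

/-- `F^±` as a subset of `H`. -/
def FH (s : Sgn) : Set H := S.incl ⁻¹' S.F s

/-- `F^±_{H,ρ}`, the closed `ρ`-tube around `F^±` in `H`. -/
def tubeH (s : Sgn) (ρ : ℝ) : Set H := {v | Metric.infDist v (S.FH s) ≤ ρ}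

/-- The potential restricted to `H`, where it is finite. -/
def EH (v : H) : ℝ := (S.E (S.incl v)).toReal

/-- The potential is an unbalanced double well with respect to `F^-` and `F^+`. -/
structure HypUnbalanced : Prop where
  /-- (sequential) weak lower semicontinuity -/
  weak_lsc : ∀ (u : ℕ → L) (v : L),
    (∀ w : L, Tendsto (fun n => inner ℝ (u n) w) atTop (𝓝 (inner ℝ v w))) →
      S.E v ≤ liminf (fun n => S.E (u n)) atTop
  nonempty : ∀ s, (S.F s).Nonempty
  closed : ∀ s, IsClosed (S.F s)
  a_neg : S.a < 0
  minimum : ∀ v : L, ∀ w ∈ S.F .minus, S.E w ≤ S.E v ∧ S.E w = (S.a : EReal)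
  local_minimum : ∀ w ∈ S.F .plus, IsLocalMin S.E w ∧ S.E w = 0
  r_pos : ∀ s, 0 < S.r s
  disjoint : S.tube .plus (S.r .plus) ∩ S.tube .minus (S.r .minus) = ∅
  one_lt_C : ∀ s, 1 < S.C s
  coercive : ∀ s, ∀ v ∈ S.tube s (S.r s),
    (((S.C s)⁻¹ * Metric.infDist v (S.F s) ^ 2 : ℝ) : EReal) ≤ S.E v - (S.level s : EReal)
  unique_nearest : ∀ s, ∀ v ∈ S.tube s (S.r s),
    ∃! w : L, w ∈ S.F s ∧ ‖v - w‖ = Metric.infDist v (S.F s)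
  P_spec : ∀ s, ∀ v ∈ S.tube s (S.r s),
    S.P s v ∈ S.F s ∧ ‖v - S.P s v‖ = Metric.infDist v (S.F s)
  P_smooth : ∀ s, ContDiffOn ℝ 2 (S.P s) (S.tube s (S.r s))

/-- `H` is the finiteness domain of the potential, which is `C¹` on `H`, and its differential is
represented by the inner product of `L` on the smaller space `Ht`. -/
structure HypSmallerSpace : Prop where
  incl_injective : Function.Injective S.incl
  range_incl : Set.range S.incl = {v : L | S.E v < ⊤}
  norm_incl_le : ∀ v : H, ‖S.incl v‖ ≤ ‖v‖
  E_smooth : ContDiff ℝ 1 S.EH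
  inclt_injective : Function.Injective S.inclt
  norm_inclt_le : ∀ v : Ht, ‖S.inclt v‖ ≤ ‖v‖
  DL_continuous : Continuous S.DL
  DL_spec : ∀ (v : Ht) (w : H), inner ℝ (S.DL v) (S.incl w) = fderiv ℝ S.EH (S.inclt v) w

/-- `L`-bounded subsets of `F^±` are (relatively) compact in `H`. -/
def HypCompactness : Prop :=
  ∀ s, ∀ A ⊆ S.F s, Bornology.IsBounded A → IsCompact (closure (S.incl ⁻¹' A))

/-- Either `F^±` is bounded in `L`, or the projections onto `F^±` can be inverted. -/
def HypProjectionsInverse : Prop :=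
  ∀ s, Bornology.IsBounded (S.F s) ∨
    ∀ v ∈ S.tube s (S.r s), ∀ w ∈ S.F s, ∃ Q : L → L,
      S.P s (Q v) = w ∧
      Metric.infDist (Q v) (S.F s) = Metric.infDist v (S.F s) ∧
      Differentiable ℝ Q ∧
      (∀ w₁ w₂ : L, ‖fderiv ℝ Q w₁ w₂‖ = ‖w₂‖) ∧
      S.E (Q v) = S.E v

/-- Local properties of the potential around `F^±` in the norm of `H`. -/
structure HypProjectionsH : Prop where
  unique_nearest : ∀ s, ∀ v ∈ S.tubeH s (S.r s),
    ∃! w : H, w ∈ S.FH s ∧ ‖v - w‖ = Metric.infDist v (S.FH s)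
  PH_spec : ∀ s, ∀ v ∈ S.tubeH s (S.r s),
    S.PH s v ∈ S.FH s ∧ ‖v - S.PH s v‖ = Metric.infDist v (S.FH s)
  PH_smooth : ∀ s, ContDiffOn ℝ 1 (S.PH s) (S.tubeH s (S.r s))
  /-- here `p` is `P^±(v)`, seen as an element of `H` -/
  difference : ∀ s, ∀ v ∈ S.tubeH s (S.r s), ∀ p : H, S.incl p = S.P s (S.incl v) →
    ‖p - S.PH s v‖ ≤ S.C s * ‖v - S.PH s v‖
  beta_pos : ∀ s, ∀ ρ ∈ Set.Ioc 0 (S.r s), 0 < S.beta s ρ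
  local_bound : ∀ s, ∀ ρ ∈ Set.Ioc 0 (S.r s), ∀ v ∈ S.tube s (S.r s),
    S.E v ≤ ((S.level s + S.beta s ρ : ℝ) : EReal) → ∃ w ∈ S.tubeH s ρ, S.incl w = v
  lower_est : ∀ s, ∀ v ∈ S.tubeH s (S.r s),
    (S.C s ^ 2)⁻¹ * ‖v - S.PH s v‖ ^ 2 ≤ S.EH v - S.level s
  upper_est : ∀ s, ∀ v ∈ S.tubeH s (S.r s),
    S.EH v - S.level s ≤ S.C s ^ 2 * ‖v - S.PH s v‖ ^ 2

/-- The energy density `(‖U'(t)‖² / 2 + E(U(t))) exp(c t)`. -/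
def density (c : ℝ) (U : ℝ → L) (t : ℝ) : EReal :=
  (((‖deriv U t‖ ^ 2 / 2 : ℝ) : EReal) + S.E (U t)) * ((Real.exp (c * t) : ℝ) : EReal)

/-- Integral of the positive part of the energy density over `I`. -/
def energyPos (c : ℝ) (U : ℝ → L) (I : Set ℝ) : ENNReal :=
  ∫⁻ t in I, (S.density c U t).toENNReal

/-- Integral of the negative part of the energy density over `I`. -/
def energyNeg (c : ℝ) (U : ℝ → L) (I : Set ℝ) : ENNReal :=
  ∫⁻ t in I, (-(S.density c U t)).toENNReal

/-- The energy is well defined in `[-∞, +∞]`. -/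
def EnergyWellDefined (c : ℝ) (U : ℝ → L) (I : Set ℝ) : Prop :=
  S.energyPos c U I ≠ ⊤ ∨ S.energyNeg c U I ≠ ⊤

/-- The energy `E_c(U; I)`, meaningful if it is well defined. -/
def energy (c : ℝ) (U : ℝ → L) (I : Set ℝ) : EReal :=
  (S.energyPos c U I : EReal) - (S.energyNeg c U I : EReal)

/-- `U` is a local minimizer of `E_c(·; (x, y))`. -/
def IsLocalMinimizer (c : ℝ) (U : ℝ → L) (x y : ℝ) : Prop :=
  H1loc (Set.Ioo x y) U ∧
  S.energyPos c U (Set.Ioo x y) ≠ ⊤ ∧ S.energyNeg c U (Set.Ioo x y) ≠ ⊤ ∧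
  ∃ ε : ℝ, 0 < ε ∧ ∀ φ : ℝ → H, ContDiff ℝ 1 φ → HasCompactSupport φ →
    tsupport φ ⊆ Set.Ioo x y → (∀ t, ‖φ t‖ < ε) →
      S.EnergyWellDefined c (fun t => U t + S.incl (φ t)) (Set.Ioo x y) ∧
      S.energy c U (Set.Ioo x y) ≤ S.energy c (fun t => U t + S.incl (φ t)) (Set.Ioo x y)

/-- The regularity class `C²(O, L) ∩ C¹(O, H) ∩ C⁰(O, Ht)` for an open set `O`. -/
def RegClass (O : Set ℝ) (U : ℝ → L) : Prop :=
  ContDiffOn ℝ 2 U O ∧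
  (∃ V : ℝ → H, (∀ t ∈ O, S.incl (V t) = U t) ∧ ContDiffOn ℝ 1 V O) ∧
  (∃ W : ℝ → Ht, (∀ t ∈ O, S.incl (S.inclt (W t)) = U t) ∧ ContinuousOn W O)

/-- `U'' - D_L E(U) = -c U'` on the open set `O`; here `W` is `U`, seen with values in `Ht`. -/
def Solves (c : ℝ) (O : Set ℝ) (U : ℝ → L) : Prop :=
  ∃ W : ℝ → Ht, (∀ t ∈ O, S.incl (S.inclt (W t)) = U t) ∧
    ∀ t ∈ O, deriv (deriv U) t - S.DL (W t) = -(c • deriv U t)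

/-- Regularity of local minimizers that are fixed by the map `proj`. -/
structure HypRegularity : Prop where
  proj_le : ∀ v : L, S.E (S.proj v) ≤ S.E v
  proj_eq_iff : ∀ v : L, S.E v < ⊤ → (S.E (S.proj v) = S.E v ↔ S.proj v = v)
  proj_nonexpansive : ∀ v₁ v₂ : L, ‖S.proj v₁ - S.proj v₂‖ ≤ ‖v₁ - v₂‖
  proj_fix : ∀ s, ∀ v ∈ S.F s, S.proj v = v
  regular : ∀ (x y c : ℝ) (W : ℝ → L), x < y → 0 < c → S.IsLocalMinimizer c W x y →
    (∀ t ∈ Set.Ioo x y, W t = S.proj (W t)) →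
      S.RegClass (Set.Ioo x y) W ∧ S.Solves c (Set.Ioo x y) W

/-- `κ^±_ρ`, the infimum of the potential on `{v | dist(v, F^±) ∈ [ρ, r₀^±]}`. -/
def kappa (s : Sgn) (ρ : ℝ) : ℝ :=
  (sInf (S.E '' {v : L | Metric.infDist v (S.F s) ∈ Set.Icc ρ (S.r s)})).toReal

/-- The constant `η₀^-`. -/
def etaMinus : ℝ :=
  min (Real.sqrt ((Real.exp 1)⁻¹ * (S.r .minus / 4) *
      Real.sqrt (2 * (S.kappa .minus (S.r .minus / 4) - S.a))))
    (S.r .minus / 4)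

/-- The radius `r₀^- / (C^- + 1)`. -/
def rHatMinus : ℝ := S.r .minus / (S.C .minus + 1)

/-- The constant `E_max^-`. -/
def EmaxMinus : ℝ :=
  1 / (S.C .minus ^ 2 * (S.C .minus + 1)) *
    min (min (S.etaMinus ^ 2 / 4) (S.kappa .minus S.etaMinus - S.a))
      (min (S.beta .minus S.rHatMinus) (S.beta .minus S.etaMinus))

/-- The constant `(C^±)² ((C^±)² + (C^± + 1)²) / 2`. -/
def CC (s : Sgn) : ℝ := 1 / 2 * S.C s ^ 2 * (S.C s ^ 2 + (S.C s + 1) ^ 2)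

/-- The constant `γ^-`. -/
def gammaMinus : ℝ := 1 / (S.C .minus + S.CC .minus)

/-- `d₀`, the distance in `L` between the tubes of radii `r₀^± / 2` around `F^+` and `F^-`. -/
def d0 : ℝ :=
  sInf (Set.image2 dist (S.tube .plus (S.r .plus / 2)) (S.tube .minus (S.r .minus / 2)))

/-- The well `F^-` is not too deep and contains the negative level set in its tube. -/
structure HypLevelSets : Prop where
  neg_a_lt : -S.a < S.EmaxMinus
  negative_levelset : {v : L | S.E v < 0} ⊆ S.tube .minus (S.r .minus / 2)

/-- The additional bound used for the behavior at `-∞`. -/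
def HypConvergence : Prop := -S.a < (S.d0 * S.gammaMinus) ^ 2 / 2

/-- The space `X` of curves that are eventually in the tubes of radii `r₀^± / 2`. -/
def X : Set (ℝ → L) :=
  {U | H1loc Set.univ U ∧ ∃ T : ℝ, 1 ≤ T ∧
    (∀ t, T ≤ t → Metric.infDist (U t) (S.F .plus) ≤ S.r .plus / 2) ∧
    (∀ t, t ≤ -T → Metric.infDist (U t) (S.F .minus) ≤ S.r .minus / 2)}

/-- `(c, U)` is a solution as in the main existence result: `c > 0`, `U` is a regular curve in `X`
(which contains the weak conditions at `±∞`), it solves `U'' - D_L E(U) = -c U'` on `ℝ`, it is a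
global minimizer of `E_c` in `X`, with `E_c(U) = 0`, and it is fixed by the map `proj`. -/
structure IsSolution (c : ℝ) (U : ℝ → L) : Prop where
  c_pos : 0 < c
  regClass : S.RegClass Set.univ U
  mem_X : U ∈ S.X
  solves : S.Solves c Set.univ U
  isMin : ∀ V ∈ S.X, S.energy c U Set.univ ≤ S.energy c V Set.univ
  energy_eq_zero : S.energy c U Set.univ = 0
  fixed : ∀ t, U t = S.proj (U t)

end Setting

end TravelingWave

end

/-! ### Scalar differential inequalities and exponential convergence at `-∞`. -/

section Calculus

variable {L : Type*} [NormedAddCommGroup L]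

/-! Everything rests on the excess `g = E(U) - a - ‖U'‖² / 2`. Pairing the equation with `U'` gives
`g' = c ‖U'‖²`, hence `(e^{ct} g)' = c e^{ct} (‖U'‖² / 2 + E(U) - a)`: the energy on a left
half-line, measured from the level `a`, is `e^{ct} g(t) / c`. So `g` is nonnegative and
nondecreasing, and zero total energy gives `g ≤ -a`.

Speed (`speed_mul_d0_le`, `speed_lt`): after its last time in the half tube of `F^-`, the curve has
nonnegative potential and must cover the distance `d₀`. A weighted Young inequality bounds the
length by the energy, so `c d₀ ≤ √(-2a)`, which the depth assumption makes smaller than `γ d₀`.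

Decay (`excess_le_of_mem_tubeH`, `excess_decay`): replace `U` before time `t` by rest at the
projection of `U(t)` on the well, followed by a unit-time segment. Minimality yields `g ≤ cK (E(U) -
a) = cK (g + ‖U'‖² / 2)` with `K = C² / 2 + C⁴`. As `γK ≤ 1`, this gives `2(γ - c) g ≤ g'`, so `g`
decays like `e^{2(γ-c)t}`. A second use of Young's inequality turns this into a tail length of order
`e^{(γ-c)t}` (`exists_exponential_limit`). Coercivity places the limit in `F^-`. -/

theorem norm_sub_le_sub_of_norm_deriv_le [NormedSpace ℝ L] {f f' : ℝ → L} {B B' : ℝ → ℝ} {a b : ℝ}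
    (hf : ∀ x, HasDerivAt f (f' x) x) (hB : ∀ x, HasDerivAt B (B' x) x)
    (hab : a ≤ b) (hbound : ∀ x, a ≤ x → x ≤ b → ‖f' x‖ ≤ B' x) :
    ‖f b - f a‖ ≤ B b - B a := by
  have := image_norm_le_of_norm_deriv_right_le_deriv_boundary
    (f := fun x => f x - f a) (f' := f') (a := a) (b := b)
    (fun x _ => ((hf x).sub_const _).continuousAt.continuousWithinAt)
    (fun x _ => ((hf x).sub_const _).hasDerivWithinAt)
    (B := fun x => B x - B a) (B' := B') (by simp)
    (fun x => (hB x).sub_const _) (fun x hx => hbound x hx.1 hx.2.le)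
  exact this ⟨hab, le_rfl⟩

theorem monotoneOn_Icc_of_hasDerivAt_nonneg {f f' : ℝ → ℝ} {a b : ℝ}
    (hf : ∀ x, HasDerivAt f (f' x) x) (hab : a ≤ b)
    (h0 : ∀ x, a ≤ x → x ≤ b → 0 ≤ f' x) : f a ≤ f b := by
  have := monotoneOn_of_deriv_nonneg (convex_Icc a b) (f := f)
    (fun x _ => (hf x).continuousAt.continuousWithinAt)
    (fun x _ => (hf x).differentiableAt.differentiableWithinAt)
    (fun x hx => by
      rw [interior_Icc] at hx
      rw [(hf x).deriv]
      exact h0 x hx.1.le hx.2.le)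
  exact this ⟨le_rfl, hab⟩ ⟨hab, le_rfl⟩ hab

/-- Young's inequality with a weight. -/
theorem le_half_weighted_sq_add_inv (x : ℝ) {l : ℝ} (hl : 0 < l) :
    x ≤ 1 / 2 * (l * x ^ 2 + l⁻¹) := by
  have h : 0 ≤ l⁻¹ * (l * x - 1) ^ 2 := by positivity
  have h2 : l⁻¹ * (l * x - 1) ^ 2 = l * x ^ 2 - 2 * x + l⁻¹ := by
    field_simp
    ring
  linarith

/-- `B t` acts as a bound on the length of `f` over `(-∞, t]`. Dropping `B s ≥ 0` leaves a bound
uniform in `s`, which passes to the limit. -/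
theorem exists_limit_atBot_of_norm_sub_le [CompleteSpace L] {f : ℝ → L} {B : ℝ → ℝ} {t₁ : ℝ}
    (hB0 : ∀ t, 0 ≤ B t) (hB : Tendsto B atBot (𝓝 0))
    (h : ∀ s t, s ≤ t → t ≤ t₁ → ‖f t - f s‖ ≤ B t - B s) :
    ∃ v, ∀ t ≤ t₁, ‖f t - v‖ ≤ B t := by
  have hlim : Tendsto (fun n : ℕ => t₁ - (n : ℝ)) atTop atBot := by
    have := tendsto_natCast_atTop_atTop (R := ℝ)
    simpa [sub_eq_add_neg] using
      tendsto_atBot_add_const_left atTop t₁ (tendsto_neg_atTop_atBot.comp this)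
  have key : ∀ n N : ℕ, N ≤ n → dist (f (t₁ - n)) (f (t₁ - N)) ≤ B (t₁ - N) := by
    intro n N hN
    have hN' : (N : ℝ) ≤ n := by exact_mod_cast hN
    have := h (t₁ - n) (t₁ - N) (by linarith) (by linarith [Nat.cast_nonneg (α := ℝ) N])
    rw [dist_comm, dist_eq_norm]
    linarith [hB0 (t₁ - n)]
  have hc : CauchySeq (fun n : ℕ => f (t₁ - n)) := by
    refine cauchySeq_of_le_tendsto_0 (fun N => 2 * B (t₁ - N)) (fun n m N hn hm => ?_) ?_
    · have := dist_triangle_right (f (t₁ - n)) (f (t₁ - m)) (f (t₁ - N))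
      linarith [key n N hn, key m N hm]
    · simpa using (hB.comp hlim).const_mul 2
  obtain ⟨v, hv⟩ := cauchySeq_tendsto_of_complete hc
  refine ⟨v, fun t ht => ?_⟩
  refine le_of_tendsto ((tendsto_const_nhds.sub hv).norm) ?_
  filter_upwards [hlim.eventually (eventually_le_atBot t)] with n hn
  linarith [h _ _ hn ht, hB0 (t₁ - n)]

variable {U U' : ℝ → L} {g : ℝ → ℝ} {c : ℝ}

theorem monotone_of_dissipation (hc : 0 < c) (hg : ∀ t, HasDerivAt g (c * ‖U' t‖ ^ 2) t) :
    Monotone g :=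
  fun _ _ hab => monotoneOn_Icc_of_hasDerivAt_nonneg hg hab (fun _ _ _ => by positivity)

/-- Otherwise `g` would grow at rate at least `c * ε` on all of `(-∞, T]`, and would be negative far
in the past. -/
theorem exists_small_speed (hc : 0 < c) (hg : ∀ t, HasDerivAt g (c * ‖U' t‖ ^ 2) t)
    (hg0 : ∀ t, 0 ≤ g t) {ε : ℝ} (hε : 0 < ε) (T : ℝ) :
    ∃ t ≤ T, ‖U' t‖ ^ 2 < ε := by
  by_contra! hcon
  have hT := hg0 T
  set s := T - (g T + 1) / (c * ε) with hs
  have hsT : s ≤ T := by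
    have : 0 ≤ (g T + 1) / (c * ε) := by positivity
    linarith
  have h := monotoneOn_Icc_of_hasDerivAt_nonneg (f := fun t => g t - c * ε * t)
    (f' := fun t => c * ‖U' t‖ ^ 2 - c * ε * 1)
    (fun x => (hg x).sub ((hasDerivAt_id x).const_mul _)) hsT
    (fun x _ hx => by
      have := mul_le_mul_of_nonneg_left (hcon x hx) hc.le
      linarith)
  have h2 : c * ε * (T - s) = g T + 1 := by
    rw [hs]; field_simp; ring
  linarith [hg0 s]

/-- If the excess is controlled by the total energy whenever the latter is small,
then the excess decays exponentially at `-∞`. -/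
theorem excess_decay {A β K γ T : ℝ} (hc : 0 < c) (hK : 0 < K) (hγK : γ * K ≤ 1) (hcγ : c < γ)
    (hAβ : A < β) (hg : ∀ t, HasDerivAt g (c * ‖U' t‖ ^ 2) t)
    (hg0 : ∀ t, 0 ≤ g t) (hgA : ∀ t, g t ≤ A)
    (hcomp : ∀ t ≤ T, g t + ‖U' t‖ ^ 2 / 2 ≤ β → g t ≤ c * K * (g t + ‖U' t‖ ^ 2 / 2)) :
    (∀ ε > 0, ∃ t₀, ∀ t ≤ t₀, g t < ε) ∧
    ∃ t₁, ∀ t ≤ t₁, g t ≤ g t₁ * Real.exp (-(2 * (γ - c) * t₁)) * Real.exp (2 * (γ - c) * t) := by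
  have hmono := monotone_of_dissipation hc hg
  have hcK : 0 < c * K := mul_pos hc hK
  have hcK1 : c * K < 1 := by nlinarith
  have hβ : 0 < β := by linarith [hg0 0, hgA 0]
  have hsmall : ∀ ε > 0, ∃ t₀, ∀ t ≤ t₀, g t < ε := by
    intro ε hε
    -- The first entry brings the total energy below `β`, so that `hcomp` applies; the second turns
    -- `g ≤ cK (g + η)` into `g < ε`, using `cK < 1`.
    set η := min (β - A) ((1 - c * K) * ε / 2) with hη
    have hηpos : 0 < η := lt_min (by linarith) (by
      have : 0 < 1 - c * K := by linarith
      positivity)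
    obtain ⟨t₀, ht₀, hsp⟩ := exists_small_speed hc hg hg0 (ε := 2 * η) (by linarith) T
    have h1 : η ≤ β - A := min_le_left _ _
    have h2 : η ≤ (1 - c * K) * ε / 2 := min_le_right _ _
    have h3 := hcomp t₀ ht₀ (by linarith [hgA t₀])
    refine ⟨t₀, fun t ht => (hmono ht).trans_lt ?_⟩
    have h4 : (1 - c * K) * g t₀ ≤ c * K * η := by nlinarith
    have h5 : c * K * η ≤ η := by nlinarith
    have h6 : (1 - c * K) * g t₀ < (1 - c * K) * ε := by
      have : 0 < (1 - c * K) * ε := mul_pos (by linarith) hε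
      linarith
    exact lt_of_mul_lt_mul_left h6 (by linarith)
  refine ⟨hsmall, ?_⟩
  -- Below the level `cKβ` the comparison inequality also holds when the total energy exceeds `β`,
  -- so it is available at every earlier time.
  obtain ⟨t₀, ht₀⟩ := hsmall (c * K * β) (by positivity)
  refine ⟨min t₀ T, fun t ht => ?_⟩
  set t₁ := min t₀ T
  set δ := γ - c with hδ
  have hder : ∀ x, HasDerivAt (fun x => g x * Real.exp (-(2 * δ * x)))
      (c * ‖U' x‖ ^ 2 * Real.exp (-(2 * δ * x)) +
        g x * (Real.exp (-(2 * δ * x)) * -(2 * δ * 1))) x := fun x =>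
    (hg x).mul (((hasDerivAt_id x).const_mul (2 * δ)).neg.exp)
  have key := monotoneOn_Icc_of_hasDerivAt_nonneg hder ht (fun x _ hx => by
    have hx0 : x ≤ t₀ := hx.trans (min_le_left _ _)
    have hxT : x ≤ T := hx.trans (min_le_right _ _)
    have hn : 0 ≤ ‖U' x‖ ^ 2 := by positivity
    have h1 : g x ≤ c * K * (g x + ‖U' x‖ ^ 2 / 2) := by
      by_cases hb : g x + ‖U' x‖ ^ 2 / 2 ≤ β
      · exact hcomp x hxT hb
      · refine (ht₀ x hx0).le.trans ?_
        exact mul_le_mul_of_nonneg_left (not_le.mp hb).le hcK.le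
    -- This is `g' ≥ 2δ g`, obtained by multiplying `h1` by `γ` and using `γK ≤ 1`; it makes `g
    -- e^{-2δx}` nondecreasing.
    have h2 : 2 * δ * g x ≤ c * ‖U' x‖ ^ 2 := by
      have h3 : γ * g x ≤ γ * (c * K * (g x + ‖U' x‖ ^ 2 / 2)) :=
        mul_le_mul_of_nonneg_left h1 (by linarith)
      have h4 : γ * (c * K * (g x + ‖U' x‖ ^ 2 / 2)) ≤ c * (g x + ‖U' x‖ ^ 2 / 2) := by
        have : 0 ≤ c * (g x + ‖U' x‖ ^ 2 / 2) :=
          mul_nonneg hc.le (by linarith [hg0 x])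
        nlinarith
      rw [hδ]
      linarith
    have h5 := mul_le_mul_of_nonneg_right h2 (Real.exp_pos (-(2 * δ * x))).le
    linarith)
  have h7 := mul_le_mul_of_nonneg_right key (Real.exp_pos (2 * δ * t)).le
  rwa [mul_assoc (g t), ← Real.exp_add, neg_add_cancel, Real.exp_zero, mul_one] at h7

/-- A curve whose excess decays exponentially at `-∞` converges exponentially at `-∞`. -/
theorem exists_exponential_limit [NormedSpace ℝ L] [CompleteSpace L] {A γ G t₁ : ℝ} (hc : 0 < c) (hcγ : c < γ)
    (hU : ∀ t, HasDerivAt U (U' t) t)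
    (hg : ∀ t, HasDerivAt g (c * ‖U' t‖ ^ 2) t)
    (hg0 : ∀ t, 0 ≤ g t) (hgA : ∀ t, g t ≤ A)
    (hdecay : ∀ t ≤ t₁, g t ≤ G * Real.exp (2 * (γ - c) * t)) :
    ∃ v, Tendsto U atBot (𝓝 v) ∧ ∃ M, 0 < M ∧ ∀ t, ‖U t - v‖ ≤ M * Real.exp ((γ - c) * t) := by
  set δ := γ - c with hδ
  have hδ0 : 0 < δ := by linarith
  have hG : 0 ≤ G := by
    have := (hg0 t₁).trans (hdecay t₁ le_rfl)
    exact nonneg_of_mul_nonneg_left this (Real.exp_pos _)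
  -- `b'` must dominate `(e^{-δt} ‖U'‖² + e^{δt}) / 2`. The summand `1 / δ` produces the second
  -- exponential, and `G / c` absorbs the negative term from differentiating the weight on `g`.
  set m : ℝ := G / c + 1 / δ with hm
  have hm0 : 0 < m := by positivity
  set b : ℝ → ℝ := fun t => 1 / 2 * (g t * Real.exp (-(δ * t)) / c + m * Real.exp (δ * t)) with hb
  have hexp : ∀ t, Real.exp (2 * δ * t) = Real.exp (δ * t) * Real.exp (δ * t) := fun t => by
    rw [← Real.exp_add]; ring_nf
  have hinv : ∀ t, Real.exp (δ * t) * Real.exp (-(δ * t)) = 1 := fun t => by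
    rw [← Real.exp_add, add_neg_cancel, Real.exp_zero]
  have hge : ∀ t ≤ t₁, g t * Real.exp (-(δ * t)) ≤ G * Real.exp (δ * t) := fun t ht => by
    have h1 := mul_le_mul_of_nonneg_right (hdecay t ht) (Real.exp_pos (-(δ * t))).le
    rwa [hexp, mul_assoc G, mul_assoc (Real.exp (δ * t)), hinv, mul_one] at h1
  have hbd : ∀ t, HasDerivAt b (1 / 2 * ((c * ‖U' t‖ ^ 2 * Real.exp (-(δ * t)) +
      g t * (Real.exp (-(δ * t)) * -(δ * 1))) / c + m * (Real.exp (δ * t) * (δ * 1)))) t := fun t =>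
    (((((hg t).mul (((hasDerivAt_id t).const_mul δ).neg.exp)).div_const c).add
      ((((hasDerivAt_id t).const_mul δ).exp).const_mul m)).const_mul (1 / 2))
  have hb0 : ∀ t, 0 ≤ b t := fun t => by
    have := hg0 t
    simp only [hb]
    positivity
  have hble : ∀ t ≤ t₁, b t ≤ (G / c + m) * Real.exp (δ * t) := fun t ht => by
    have h1 : g t * Real.exp (-(δ * t)) / c ≤ G / c * Real.exp (δ * t) := by
      rw [div_mul_eq_mul_div]
      exact div_le_div_of_nonneg_right (hge t ht) hc.le
    have h2 : 0 ≤ G / c * Real.exp (δ * t) := by positivity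
    have h3 : 0 ≤ m * Real.exp (δ * t) := by positivity
    simp only [hb]
    linarith
  have hexp0 : Tendsto (fun t => (G / c + m) * Real.exp (δ * t)) atBot (𝓝 0) := by
    have := (Real.tendsto_exp_atBot.comp (tendsto_id.const_mul_atBot hδ0)).const_mul (G / c + m)
    simpa using this
  have hbt : Tendsto b atBot (𝓝 0) := by
    refine squeeze_zero' (Eventually.of_forall hb0) ?_ hexp0
    filter_upwards [eventually_le_atBot t₁] with t ht using hble t ht
  obtain ⟨v, hv⟩ := exists_limit_atBot_of_norm_sub_le (f := U) hb0 hbt (t₁ := t₁)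
    (fun s t hst ht => norm_sub_le_sub_of_norm_deriv_le hU hbd hst (fun x _ hx => by
      have h1 := le_half_weighted_sq_add_inv ‖U' x‖ (Real.exp_pos (-(δ * x)))
      rw [← Real.exp_neg, neg_neg] at h1
      have h2 := hge x (hx.trans ht)
      have h3 : (c * ‖U' x‖ ^ 2 * Real.exp (-(δ * x)) +
          g x * (Real.exp (-(δ * x)) * -(δ * 1))) / c + m * (Real.exp (δ * x) * (δ * 1)) =
          ‖U' x‖ ^ 2 * Real.exp (-(δ * x)) + Real.exp (δ * x) +
          δ / c * (G * Real.exp (δ * x) - g x * Real.exp (-(δ * x))) := by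
        rw [hm]; field_simp; ring
      have h4 : 0 ≤ δ / c * (G * Real.exp (δ * x) - g x * Real.exp (-(δ * x))) :=
        mul_nonneg (by positivity) (by linarith)
      rw [h3]
      linarith))
  refine ⟨v, ?_, ?_⟩
  · rw [tendsto_iff_norm_sub_tendsto_zero]
    refine squeeze_zero' (Eventually.of_forall fun _ => norm_nonneg _) ?_ hbt
    filter_upwards [eventually_le_atBot t₁] with t ht using hv t ht
  -- To the right of `t₁` only `g ≤ A` is known. It gives linear growth of `U`, which the
  -- exponential dominates.
  have hlin : ∀ t, t₁ ≤ t → ‖U t - U t₁‖ ≤ 1 / 2 * (g t / c + t) - 1 / 2 * (g t₁ / c + t₁) :=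
    fun t ht => norm_sub_le_sub_of_norm_deriv_le hU
      (B := fun t => 1 / 2 * (g t / c + t)) (B' := fun t => 1 / 2 * (c * ‖U' t‖ ^ 2 / c + 1))
      (fun x => (((hg x).div_const c).add (hasDerivAt_id x)).const_mul (1 / 2)) ht
      (fun x _ _ => by
        have h1 := le_half_weighted_sq_add_inv ‖U' x‖ one_pos
        rw [mul_div_cancel_left₀ _ hc.ne']
        simpa using h1)
  have hA : 0 ≤ A := (hg0 0).trans (hgA 0)
  have he1 := Real.exp_pos (-(δ * t₁))
  set N : ℝ := b t₁ + 1 / 2 * (A / c) with hN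
  have hN0 : 0 ≤ N := by
    have := hb0 t₁
    positivity
  refine ⟨(G / c + m) + (N + 1 / (2 * δ)) * Real.exp (-(δ * t₁)), by positivity, fun t => ?_⟩
  rcases le_total t t₁ with ht | ht
  · refine (hv t ht).trans ((hble t ht).trans ?_)
    refine mul_le_mul_of_nonneg_right ?_ (Real.exp_pos _).le
    have : 0 ≤ (N + 1 / (2 * δ)) * Real.exp (-(δ * t₁)) := by positivity
    linarith
  · have h1 : ‖U t - v‖ ≤ ‖U t - U t₁‖ + ‖U t₁ - v‖ := by
      simpa using norm_add_le (U t - U t₁) (U t₁ - v)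
    have h2 : g t / c ≤ A / c := div_le_div_of_nonneg_right (hgA t) hc.le
    have h3 : 0 ≤ g t₁ / c := div_nonneg (hg0 _) hc.le
    have h4 : ‖U t - v‖ ≤ N + 1 / 2 * (t - t₁) := by
      linarith [hlin t ht, hv t₁ le_rfl]
    have h5 : δ * (t - t₁) + 1 ≤ Real.exp (δ * (t - t₁)) := Real.add_one_le_exp _
    have h6 : 1 ≤ Real.exp (δ * (t - t₁)) :=
      Real.one_le_exp (mul_nonneg hδ0.le (by linarith))
    have h7 : 1 / 2 * (t - t₁) ≤ 1 / (2 * δ) * Real.exp (δ * (t - t₁)) := by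
      have : 1 / 2 * (t - t₁) = 1 / (2 * δ) * (δ * (t - t₁)) := by field_simp
      rw [this]
      exact mul_le_mul_of_nonneg_left (by linarith) (by positivity)
    have h8 : N ≤ N * Real.exp (δ * (t - t₁)) := le_mul_of_one_le_right hN0 h6
    have h9 : Real.exp (δ * (t - t₁)) = Real.exp (-(δ * t₁)) * Real.exp (δ * t) := by
      rw [← Real.exp_add]; ring_nf
    have h10 : 0 ≤ (G / c + m) * Real.exp (δ * t) := by positivity
    rw [h9] at h7 h8
    linarith

end Calculus

/-! ### Integral comparison and the energy as a real integral. -/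

noncomputable section

namespace TravelingWave

/-- Meant for the comparison curve, which may have corners at two times. -/
theorem H1loc_of_hasDerivAt_off_countable {L : Type*} [NormedAddCommGroup L] [NormedSpace ℝ L]
    [CompleteSpace L] {U D : ℝ → L} {s : Set ℝ} (hs : s.Countable) (hU : Continuous U)
    (hD : StronglyMeasurable D) (hbd : ∀ a b : ℝ, ∃ M, ∀ x ∈ Set.uIcc a b, ‖D x‖ ≤ M)
    (hd : ∀ x ∉ s, HasDerivAt U (D x) x) : H1loc Set.univ U := by
  have hfin : ∀ a b : ℝ, IsFiniteMeasure (volume.restrict (Set.uIcc a b)) := fun a b =>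
    ⟨by simp [Set.uIcc]⟩
  have hmem : ∀ (a b : ℝ), MemLp D 2 (volume.restrict (Set.uIcc a b)) := fun a b => by
    obtain ⟨M, hM⟩ := hbd a b
    exact MemLp.of_bound hD.aestronglyMeasurable M
      (ae_restrict_of_forall_mem measurableSet_uIcc hM)
  refine ⟨D, fun a b _ => hmem a b, fun a b _ => ?_⟩
  refine (integral_eq_of_hasDerivAt_off_countable U D hs hU.continuousOn
    (fun x hx => hd x hx.2) ?_).symm
  rw [intervalIntegrable_iff']
  exact (hmem a b).integrable (by norm_num)

/-- Comparison of two integrals of functions that agree on `(t, ∞)`. -/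
theorem setIntegral_Iic_le_of_integral_le {f h : ℝ → ℝ} {a c t R : ℝ} (hc : 0 < c)
    (hf : Integrable f) (hh : AEStronglyMeasurable h) (heq : ∀ s, t < s → h s = f s)
    (hlow : ∀ s ≤ t, a * Real.exp (c * s) ≤ h s)
    (hup : ∀ s ≤ t, h s ≤ (a + R) * Real.exp (c * s))
    (hfar : ∀ s ≤ t - 1, h s = a * Real.exp (c * s)) (hR : 0 ≤ R) :
    Integrable h ∧ (∫ s, f s ≤ ∫ s, h s →
      ∫ s in Set.Iic t, (f s - a * Real.exp (c * s)) ≤ R * Real.exp (c * t)) := by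
  have hexp : IntegrableOn (fun s => a * Real.exp (c * s)) (Set.Iic t) :=
    (integrableOn_exp_mul_Iic hc t).const_mul a
  have hfI : IntegrableOn f (Set.Iic t) := hf.integrableOn
  have hfJ : IntegrableOn f (Set.Ioi t) := hf.integrableOn
  have hhI : IntegrableOn h (Set.Iic t) := by
    refine Integrable.mono' (((integrableOn_exp_mul_Iic hc t)).const_mul (|a| + R)) hh.restrict ?_
    refine ae_restrict_of_forall_mem measurableSet_Iic fun s hs => ?_
    have he := (Real.exp_pos (c * s)).le
    rw [Real.norm_eq_abs, abs_le]
    constructor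
    · refine le_trans ?_ (hlow s hs)
      have := mul_le_mul_of_nonneg_right (neg_abs_le a) he
      have := mul_nonneg hR he
      linarith
    · refine (hup s hs).trans ?_
      exact mul_le_mul_of_nonneg_right (by linarith [le_abs_self a]) he
  have hhJ : IntegrableOn h (Set.Ioi t) :=
    hfJ.congr_fun (fun s hs => (heq s hs).symm) measurableSet_Ioi
  have hhint : Integrable h := by
    rw [← integrableOn_univ, ← Set.Iic_union_Ioi (a := t)]
    exact hhI.union hhJ
  refine ⟨hhint, fun hle => ?_⟩
  rw [← intervalIntegral.integral_Iic_add_Ioi hfI hfJ,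
    ← intervalIntegral.integral_Iic_add_Ioi hhI hhJ,
    setIntegral_congr_fun measurableSet_Ioi (fun s hs => heq s hs)] at hle
  rw [integral_sub hfI hexp]
  -- The integrand on the left vanishes up to `t - 1`, and is at most `R e^{ct}` on the remaining
  -- interval of length one.
  have h1 : ∫ s in Set.Iic t, (h s - a * Real.exp (c * s)) ≤
      ∫ s in Set.Iic t, (Set.Ioc (t - 1) t).indicator (fun _ => R * Real.exp (c * t)) s := by
    refine setIntegral_mono_on (hhI.sub hexp) ?_ measurableSet_Iic fun s hs => ?_
    · refine Integrable.integrableOn ?_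
      rw [integrable_indicator_iff measurableSet_Ioc]
      exact integrableOn_const (by simp)
    · by_cases hst : t - 1 < s
      · rw [Set.indicator_of_mem (show s ∈ Set.Ioc (t - 1) t from ⟨hst, hs⟩)]
        have h2 : Real.exp (c * s) ≤ Real.exp (c * t) :=
          Real.exp_le_exp.mpr (mul_le_mul_of_nonneg_left hs hc.le)
        have := mul_le_mul_of_nonneg_left h2 hR
        linarith [hup s hs]
      · rw [Set.indicator_of_notMem (fun h => hst h.1), hfar s (not_lt.mp hst), sub_self]
  rw [integral_sub hhI hexp, setIntegral_indicator measurableSet_Ioc,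
    Set.inter_eq_right.mpr Set.Ioc_subset_Iic_self, setIntegral_const] at h1
  simp at h1
  linarith

namespace Setting

variable {L H Ht : Type*}
  [NormedAddCommGroup L] [InnerProductSpace ℝ L]
  [NormedAddCommGroup H] [InnerProductSpace ℝ H]
  [NormedAddCommGroup Ht] [InnerProductSpace ℝ Ht]
  {S : Setting L H Ht}

theorem HypUnbalanced.le_E (hB : S.HypUnbalanced) (v : L) : (S.a : EReal) ≤ S.E v := by
  obtain ⟨w, hw⟩ := hB.nonempty .minus
  obtain ⟨h1, h2⟩ := hB.minimum v w hw
  rwa [← h2]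

theorem coe_EH (hB : S.HypUnbalanced) (hS : S.HypSmallerSpace) (v : H) :
    (S.EH v : EReal) = S.E (S.incl v) := by
  have h1 : S.incl v ∈ {v : L | S.E v < ⊤} := hS.range_incl ▸ Set.mem_range_self v
  exact EReal.coe_toReal (ne_of_lt h1)
    (ne_of_gt ((EReal.bot_lt_coe S.a).trans_le (hB.le_E _)))

theorem a_le_EH (hB : S.HypUnbalanced) (hS : S.HypSmallerSpace) (v : H) : S.a ≤ S.EH v := by
  have := hB.le_E (S.incl v)
  rw [← coe_EH hB hS] at this
  exact_mod_cast this

theorem level_minus (hB : S.HypUnbalanced) : S.level .minus = S.a := by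
  have := hB.a_neg
  simp [level, Sgn.val, this.le]

theorem energyPos_eq {c : ℝ} {U : ℝ → L} {f : ℝ → ℝ}
    (h : ∀ᵐ t, S.density c U t = (f t : EReal)) :
    S.energyPos c U Set.univ = ∫⁻ t, ENNReal.ofReal (f t) := by
  rw [energyPos, Measure.restrict_univ]
  refine lintegral_congr_ae ?_
  filter_upwards [h] with t ht
  rw [ht, EReal.real_coe_toENNReal]

theorem energyNeg_eq {c : ℝ} {U : ℝ → L} {f : ℝ → ℝ}
    (h : ∀ᵐ t, S.density c U t = (f t : EReal)) :
    S.energyNeg c U Set.univ = ∫⁻ t, ENNReal.ofReal (-f t) := by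
  rw [energyNeg, Measure.restrict_univ]
  refine lintegral_congr_ae ?_
  filter_upwards [h] with t ht
  rw [ht, ← EReal.coe_neg, EReal.real_coe_toENNReal]

theorem energy_eq_integral {c : ℝ} {U : ℝ → L} {f : ℝ → ℝ}
    (h : ∀ᵐ t, S.density c U t = (f t : EReal)) (hf : Integrable f) :
    S.energy c U Set.univ = ((∫ t, f t : ℝ) : EReal) := by
  have h1 : ∫⁻ t, ENNReal.ofReal (f t) ≠ ⊤ := hf.lintegral_lt_top.ne
  have h2 : ∫⁻ t, ENNReal.ofReal (-f t) ≠ ⊤ := hf.neg.lintegral_lt_top.ne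
  rw [energy, energyPos_eq h, energyNeg_eq h,
    integral_eq_lintegral_pos_part_sub_lintegral_neg_part hf, EReal.coe_sub,
    EReal.coe_ennreal_toReal h1, EReal.coe_ennreal_toReal h2]

/-- In `EReal` a difference with an infinite term is `⊤` or `⊥`, even `⊤ - ⊤ = ⊥`. The value zero
thus forces both parts to be finite. -/
theorem integrable_of_energy_eq_zero {c : ℝ} {U : ℝ → L} {f : ℝ → ℝ}
    (h : ∀ᵐ t, S.density c U t = (f t : EReal)) (hf : AEStronglyMeasurable f)
    (h0 : S.energy c U Set.univ = 0) : Integrable f := by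
  rw [energy, energyPos_eq h, energyNeg_eq h] at h0
  have h1 : ∫⁻ t, ENNReal.ofReal (f t) ≠ ⊤ := by
    intro htop
    rw [htop] at h0
    induction hx : ∫⁻ t, ENNReal.ofReal (-f t) <;> simp [hx] at h0
  have h2 : ∫⁻ t, ENNReal.ofReal (-f t) ≠ ⊤ := by
    intro htop
    rw [htop] at h0
    simp at h0
  refine ⟨hf, ?_⟩
  rw [hasFiniteIntegral_iff_norm]
  have h3 : ∀ t, ENNReal.ofReal ‖f t‖ ≤ ENNReal.ofReal (f t) + ENNReal.ofReal (-f t) := by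
    intro t
    rw [Real.norm_eq_abs]
    rcases abs_choice (f t) with h | h <;> rw [h]
    · exact le_self_add
    · exact le_add_self
  refine (lintegral_mono h3).trans_lt ?_
  rw [lintegral_add_left' hf.aemeasurable.ennreal_ofReal]
  exact ENNReal.add_lt_top.mpr ⟨h1.lt_top, h2.lt_top⟩

/-! ### The energy identity along a solution. -/

/-- The energy density of a curve with values in `H`, as a real number. -/
def realDensity (S : Setting L H Ht) (c : ℝ) (D : ℝ → L) (V : ℝ → H) (t : ℝ) : ℝ :=
  (‖D t‖ ^ 2 / 2 + S.EH (V t)) * Real.exp (c * t)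

theorem density_eq_realDensity (hB : S.HypUnbalanced) (hS : S.HypSmallerSpace) {c : ℝ} {U : ℝ → L}
    {D : ℝ → L} {V : ℝ → H} {t : ℝ} (hV : S.incl (V t) = U t) (hD : deriv U t = D t) :
    S.density c U t = (S.realDensity c D V t : EReal) := by
  rw [density, realDensity, ← hV, hD, ← coe_EH hB hS, ← EReal.coe_add, ← EReal.coe_mul]

/-- `V` is `U` seen with values in `H`, and `U` satisfies the energy identity of solutions. -/
structure Profile (S : Setting L H Ht) (c : ℝ) (U : ℝ → L) (V : ℝ → H) : Prop where
  incl_eq : ∀ t, S.incl (V t) = U t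
  continuous : Continuous V
  hasDerivAt : ∀ t, HasDerivAt U (deriv U t) t
  continuous_deriv : Continuous (deriv U)
  hamiltonian : ∀ t, HasDerivAt (fun t => S.EH (V t) - S.a - ‖deriv U t‖ ^ 2 / 2)
    (c * ‖deriv U t‖ ^ 2) t

/-- By the chain rule in `H`, `E(U)' = ⟨D_L E(U), U'⟩ = ⟨U'' + cU', U'⟩`; the `U''` term cancels
against the derivative of the kinetic energy. -/
theorem IsSolution.exists_profile (hS : S.HypSmallerSpace) {c : ℝ}
    {U : ℝ → L} (hU : S.IsSolution c U) : ∃ V, Profile S c U V := by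
  obtain ⟨hU2, ⟨V, hV, hV1⟩, -⟩ := hU.regClass
  obtain ⟨W, hW, hsol⟩ := hU.solves
  rw [contDiffOn_univ] at hU2 hV1
  simp only [Set.mem_univ, true_implies] at hV hW hsol
  have hVW : ∀ t, S.inclt (W t) = V t := fun t => hS.incl_injective ((hW t).trans (hV t).symm)
  have hdU : ∀ t, HasDerivAt U (deriv U t) t := fun t =>
    (hU2.differentiable (by norm_num) t).hasDerivAt
  have hU1 : ContDiff ℝ 1 (deriv U) := by
    have : ContDiff ℝ (1 + 1) U := by norm_num; exact hU2
    exact (contDiff_succ_iff_deriv.mp this).2.2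
  have hddU : ∀ t, HasDerivAt (deriv U) (deriv (deriv U) t) t := fun t =>
    (hU1.differentiable (by norm_num) t).hasDerivAt
  refine ⟨V, hV, hV1.continuous, hdU, hU1.continuous, fun t => ?_⟩
  have hdV : HasDerivAt V (deriv V t) t := (hV1.differentiable (by norm_num) t).hasDerivAt
  have hinc : S.incl (deriv V t) = deriv U t := by
    have h1 : HasDerivAt (fun s => S.incl (V s)) (S.incl (deriv V t)) t :=
      S.incl.hasFDerivAt.comp_hasDerivAt t hdV
    rw [funext hV] at h1
    exact h1.unique (hdU t)
  have hE : HasDerivAt (fun s => S.EH (V s)) (fderiv ℝ S.EH (V t) (deriv V t)) t :=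
    (hS.E_smooth.differentiable (by norm_num) (V t)).hasFDerivAt.comp_hasDerivAt t hdV
  rw [← hVW t, ← hS.DL_spec, hinc] at hE
  have h2 := (hE.sub_const S.a).sub ((hddU t).norm_sq.div_const 2)
  refine h2.congr_deriv ?_
  have h3 : S.DL (W t) = deriv (deriv U) t + c • deriv U t := by
    have := hsol t
    rw [sub_eq_iff_eq_add] at this
    rw [this]; abel
  rw [h3, inner_add_left, inner_smul_left, real_inner_self_eq_norm_sq, real_inner_comm]
  simp

section

variable {c : ℝ} {U : ℝ → L} {V : ℝ → H}

theorem Profile.continuous_realDensity (hS : S.HypSmallerSpace) (hP : Profile S c U V) :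
    Continuous (S.realDensity c (deriv U) V) := by
  have h1 := hP.continuous_deriv
  have h2 : Continuous fun t => S.EH (V t) := hS.E_smooth.continuous.comp hP.continuous
  unfold realDensity
  fun_prop

theorem Profile.density_eq (hB : S.HypUnbalanced) (hS : S.HypSmallerSpace)
    (hP : Profile S c U V) :
    ∀ᵐ t, S.density c U t = (S.realDensity c (deriv U) V t : EReal) :=
  Eventually.of_forall fun t => density_eq_realDensity hB hS (hP.incl_eq t) rfl

theorem Profile.integrable (hB : S.HypUnbalanced) (hS : S.HypSmallerSpace)
    (hP : Profile S c U V) (h0 : S.energy c U Set.univ = 0) :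
    Integrable (S.realDensity c (deriv U) V) :=
  integrable_of_energy_eq_zero (hP.density_eq hB hS)
    (hP.continuous_realDensity hS).aestronglyMeasurable h0

theorem Profile.integral_eq_zero (hB : S.HypUnbalanced) (hS : S.HypSmallerSpace)
    (hP : Profile S c U V) (h0 : S.energy c U Set.univ = 0) :
    ∫ t, S.realDensity c (deriv U) V t = 0 := by
  rw [energy_eq_integral (hP.density_eq hB hS) (hP.integrable hB hS h0)] at h0
  exact_mod_cast h0

/-- The difference between potential excess and kinetic energy. -/
def excess (S : Setting L H Ht) (U : ℝ → L) (V : ℝ → H) (t : ℝ) : ℝ :=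
  S.EH (V t) - S.a - ‖deriv U t‖ ^ 2 / 2

theorem Profile.hasDerivAt_exp_mul_excess (hP : Profile S c U V) (t : ℝ) :
    HasDerivAt (fun t => Real.exp (c * t) * S.excess U V t)
      (c * (S.realDensity c (deriv U) V t - S.a * Real.exp (c * t))) t := by
  have h1 := (((hasDerivAt_id t).const_mul c).exp).mul (hP.hamiltonian t)
  refine h1.congr_deriv ?_
  simp only [realDensity, id]
  ring

/-- The energy on a half-line is given by the excess at its end point. -/
theorem Profile.setIntegral_Iic (hB : S.HypUnbalanced) (hS : S.HypSmallerSpace)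
    (hP : Profile S c U V) (hc : 0 < c) (h0 : S.energy c U Set.univ = 0) (t : ℝ) :
    c * ∫ s in Set.Iic t, (S.realDensity c (deriv U) V s - S.a * Real.exp (c * s)) =
      Real.exp (c * t) * S.excess U V t := by
  have hint : IntegrableOn (fun s => S.realDensity c (deriv U) V s - S.a * Real.exp (c * s))
      (Set.Iic t) :=
    (hP.integrable hB hS h0).integrableOn.sub ((integrableOn_exp_mul_Iic hc t).const_mul S.a)
  have hcont : Continuous fun s => Real.exp (c * s) * S.excess U V s :=
    continuous_iff_continuousAt.mpr fun s => (hP.hasDerivAt_exp_mul_excess s).continuousAt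
  -- Since `|g| ≤ E(U) - a + ‖U'‖² / 2`, the function `e^{cs} g` is integrable along with its
  -- derivative, so it tends to zero at `-∞` and leaves no boundary term.
  have hint2 : IntegrableOn (fun s => Real.exp (c * s) * S.excess U V s) (Set.Iic t) := by
    refine Integrable.mono' hint hcont.aestronglyMeasurable (Eventually.of_forall fun s => ?_)
    have h1 := a_le_EH hB hS (V s)
    have h2 : 0 ≤ ‖deriv U s‖ ^ 2 := by positivity
    have h3 : S.realDensity c (deriv U) V s - S.a * Real.exp (c * s) =
        Real.exp (c * s) * (S.EH (V s) - S.a + ‖deriv U s‖ ^ 2 / 2) := by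
      rw [realDensity]; ring
    rw [h3, norm_mul, Real.norm_eq_abs, Real.abs_exp]
    refine mul_le_mul_of_nonneg_left ?_ (Real.exp_pos _).le
    rw [Real.norm_eq_abs, abs_le, excess]
    constructor <;> linarith
  have hlim := tendsto_zero_of_hasDerivAt_of_integrableOn_Iic
    (fun s _ => hP.hasDerivAt_exp_mul_excess s) (hint.const_mul c) hint2
  rw [← integral_const_mul, integral_Iic_of_hasDerivAt_of_tendsto
    (hcont.continuousWithinAt) (fun s _ => hP.hasDerivAt_exp_mul_excess s) (hint.const_mul c) hlim,
    sub_zero]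

theorem Profile.excess_nonneg (hB : S.HypUnbalanced) (hS : S.HypSmallerSpace)
    (hP : Profile S c U V) (hc : 0 < c) (h0 : S.energy c U Set.univ = 0) (t : ℝ) :
    0 ≤ S.excess U V t := by
  have h1 : 0 ≤ ∫ s in Set.Iic t, (S.realDensity c (deriv U) V s - S.a * Real.exp (c * s)) := by
    refine setIntegral_nonneg measurableSet_Iic fun s _ => ?_
    have h1 := a_le_EH hB hS (V s)
    have h3 : S.realDensity c (deriv U) V s - S.a * Real.exp (c * s) =
        Real.exp (c * s) * (S.EH (V s) - S.a + ‖deriv U s‖ ^ 2 / 2) := by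
      rw [realDensity]; ring
    rw [h3]
    have : 0 ≤ S.EH (V s) - S.a := by linarith
    positivity
  have h2 := hP.setIntegral_Iic hB hS hc h0 t
  have h3 : 0 ≤ Real.exp (c * t) * S.excess U V t := h2 ▸ mul_nonneg hc.le h1
  exact nonneg_of_mul_nonneg_right h3 (Real.exp_pos _)

/-- The total energy is zero and the part after `t` is nonnegative, so the part before `t`, which
equals `e^{ct} (g(t) + a) / c`, is nonpositive. -/
theorem Profile.excess_le_of_nonneg (hB : S.HypUnbalanced) (hS : S.HypSmallerSpace)
    (hP : Profile S c U V) (hc : 0 < c) (h0 : S.energy c U Set.univ = 0) {t : ℝ}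
    (ht : ∀ s, t < s → 0 ≤ S.EH (V s)) : S.excess U V t ≤ -S.a := by
  have hint := hP.integrable hB hS h0
  have h1 : 0 ≤ ∫ s in Set.Ioi t, S.realDensity c (deriv U) V s := by
    refine setIntegral_nonneg measurableSet_Ioi fun s hs => ?_
    have := ht s hs
    rw [realDensity]
    positivity
  have h2 := hP.setIntegral_Iic hB hS hc h0 t
  have h3 := intervalIntegral.integral_Iic_add_Ioi (b := t) hint.integrableOn hint.integrableOn
  rw [hP.integral_eq_zero hB hS h0] at h3
  rw [integral_sub hint.integrableOn ((integrableOn_exp_mul_Iic hc t).const_mul S.a),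
    integral_const_mul, integral_exp_mul_Iic hc] at h2
  have h4 : c * (S.a * (Real.exp (c * t) / c)) = S.a * Real.exp (c * t) := by field_simp
  have h5 : Real.exp (c * t) * (S.excess U V t + S.a) ≤ 0 := by
    have : c * ∫ s in Set.Iic t, S.realDensity c (deriv U) V s ≤ 0 :=
      mul_nonpos_of_nonneg_of_nonpos hc.le (by linarith)
    linarith
  have := nonpos_of_mul_nonpos_right h5 (Real.exp_pos _)
  linarith

end

/-! ### The comparison curve issued from the well. -/

section

variable {c : ℝ} {U : ℝ → L} {V : ℝ → H}

/-- The curve that rests at `p`, moves along a segment to `w` during `[t - 1, t]`,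
and then follows `V`. -/
def connect (V : ℝ → H) (p w : H) (t s : ℝ) : H :=
  if s ≤ t then p + max 0 (s - t + 1) • (w - p) else V s

/-- The velocity of `connect`. -/
def connectDeriv (U' : ℝ → L) (x : L) (t s : ℝ) : L :=
  if s ≤ t then (if s ≤ t - 1 then 0 else x) else U' s

theorem connect_continuous (hV : Continuous V) (p : H) (t : ℝ) :
    Continuous (connect V p (V t) t) := by
  unfold connect
  refine Continuous.if_le (by fun_prop) hV continuous_id continuous_const ?_
  rintro s rfl
  simp

theorem connect_eq_of_le (V : ℝ → H) (p w : H) {t s : ℝ} (hs : s ≤ t) :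
    connect V p w t s = p + max 0 (s - t + 1) • (w - p) := if_pos hs

theorem connect_eq_of_lt (V : ℝ → H) (p w : H) {t s : ℝ} (hs : t < s) :
    connect V p w t s = V s := if_neg (not_le.mpr hs)

theorem connect_eq_of_le_sub_one (V : ℝ → H) (p w : H) {t s : ℝ} (hs : s ≤ t - 1) :
    connect V p w t s = p := by
  rw [connect_eq_of_le V p w (by linarith), max_eq_left (by linarith)]
  simp

theorem Profile.hasDerivAt_connect (hP : Profile S c U V) (p : H) {t s : ℝ}
    (h1 : s ≠ t) (h2 : s ≠ t - 1) :
    HasDerivAt (fun s => S.incl (connect V p (V t) t s))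
      (connectDeriv (deriv U) (S.incl (V t - p)) t s) s := by
  rcases lt_or_gt_of_ne h1 with hst | hst
  · rcases lt_or_gt_of_ne h2 with hs | hs
    · have hD : connectDeriv (deriv U) (S.incl (V t - p)) t s = 0 := by
        rw [connectDeriv, if_pos hst.le, if_pos hs.le]
      rw [hD]
      refine (hasDerivAt_const s (S.incl p)).congr_of_eventuallyEq ?_
      filter_upwards [Iio_mem_nhds hs] with x hx
      rw [connect_eq_of_le_sub_one _ _ _ (le_of_lt hx)]
    · have hD : connectDeriv (deriv U) (S.incl (V t - p)) t s = S.incl (V t - p) := by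
        rw [connectDeriv, if_pos hst.le, if_neg (not_le.mpr hs)]
      rw [hD]
      have h3 : HasDerivAt (fun x => S.incl p + (x - t + 1) • S.incl (V t - p))
          ((1 : ℝ) • S.incl (V t - p)) s :=
        ((((hasDerivAt_id s).sub_const t).add_const 1).smul_const _).const_add _
      rw [one_smul] at h3
      refine h3.congr_of_eventuallyEq ?_
      filter_upwards [Ioo_mem_nhds hs hst] with x hx
      rw [connect_eq_of_le _ _ _ hx.2.le, max_eq_right (by linarith [hx.1]), map_add, map_smul]
  · have hD : connectDeriv (deriv U) (S.incl (V t - p)) t s = deriv U s := by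
      rw [connectDeriv, if_neg (not_le.mpr hst)]
    rw [hD]
    refine (hP.hasDerivAt s).congr_of_eventuallyEq ?_
    filter_upwards [Ioi_mem_nhds hst] with x hx
    rw [connect_eq_of_lt _ _ _ hx, hP.incl_eq]

theorem Profile.stronglyMeasurable_connectDeriv (hP : Profile S c U V) (x : L) (t : ℝ) :
    StronglyMeasurable (connectDeriv (deriv U) x t) :=
  StronglyMeasurable.ite measurableSet_Iic
    (StronglyMeasurable.ite measurableSet_Iic stronglyMeasurable_const stronglyMeasurable_const)
    hP.continuous_deriv.stronglyMeasurable

theorem Profile.connect_mem_X [CompleteSpace L] (hP : Profile S c U V) (hX : U ∈ S.X)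
    (hr : 0 < S.r .minus) {p : H} (hp : p ∈ S.FH .minus) (t : ℝ) :
    (fun s => S.incl (connect V p (V t) t s)) ∈ S.X := by
  obtain ⟨-, T, hT1, hT2, hT3⟩ := hX
  -- Beyond `|t| + 1` the curve follows `V`; before `-(|t| + 1) ≤ t - 1` it rests at `p`.
  refine ⟨?_, max T (|t| + 1), hT1.trans (le_max_left _ _), fun s hs => ?_, fun s hs => ?_⟩
  · refine H1loc_of_hasDerivAt_off_countable (s := {t, t - 1}) (Set.toFinite _).countable
      (S.incl.continuous.comp (connect_continuous hP.continuous p t))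
      (hP.stronglyMeasurable_connectDeriv (S.incl (V t - p)) t) (fun a b => ?_) (fun s hs => ?_)
    · obtain ⟨M, hM⟩ := isCompact_uIcc.exists_bound_of_continuousOn (s := Set.uIcc a b)
        hP.continuous_deriv.continuousOn
      refine ⟨max M ‖S.incl (V t - p)‖, fun x hx => ?_⟩
      unfold connectDeriv
      split_ifs
      · simp
      · exact le_max_right _ _
      · exact (hM x hx).trans (le_max_left _ _)
    · simp only [Set.mem_insert_iff, Set.mem_singleton_iff, not_or] at hs
      exact hP.hasDerivAt_connect p hs.1 hs.2
  · have h1 := le_of_max_le_right hs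
    simp only
    rw [connect_eq_of_lt _ _ _ (by linarith [le_abs_self t]), hP.incl_eq]
    exact hT2 s (le_of_max_le_left hs)
  · have h1 : s ≤ -(|t| + 1) := hs.trans (neg_le_neg (le_max_right _ _))
    simp only
    rw [connect_eq_of_le_sub_one _ _ _ (by linarith [neg_abs_le t]),
      Metric.infDist_zero_of_mem (show S.incl p ∈ S.F .minus from hp)]
    positivity

/-- The energy along a segment from the well to a nearby point. -/
theorem EH_segment_le (hB : S.HypUnbalanced) (hH : S.HypProjectionsH) {w : H}
    (hw : w ∈ S.tubeH .minus (S.r .minus)) {θ : ℝ} (h0 : 0 ≤ θ) (h1 : θ ≤ 1) :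
    S.EH (S.PH .minus w + θ • (w - S.PH .minus w)) - S.a ≤
      S.C .minus ^ 2 * ‖w - S.PH .minus w‖ ^ 2 := by
  obtain ⟨hpF, hpd⟩ := hH.PH_spec .minus w hw
  set p := S.PH .minus w
  -- A point of the segment may have another projection than `p`, so its distance to the well,
  -- rather than to `p`, enters the upper estimate.
  have hd : Metric.infDist (p + θ • (w - p)) (S.FH .minus) ≤ ‖w - p‖ := by
    refine (Metric.infDist_le_dist_of_mem hpF).trans ?_
    rw [dist_eq_norm, add_sub_cancel_left, norm_smul, Real.norm_eq_abs, abs_of_nonneg h0]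
    exact mul_le_of_le_one_left (norm_nonneg _) h1
  have hmem : p + θ • (w - p) ∈ S.tubeH .minus (S.r .minus) := by
    refine hd.trans ?_
    rw [hpd]
    exact hw
  have h2 := hH.upper_est .minus _ hmem
  rw [(hH.PH_spec .minus _ hmem).2, level_minus hB] at h2
  refine h2.trans (mul_le_mul_of_nonneg_left ?_ (sq_nonneg _))
  exact pow_le_pow_left₀ Metric.infDist_nonneg hd 2

/-- Minimality bounds the excess by the potential energy. -/
theorem IsSolution.excess_le_of_mem_tubeH [CompleteSpace L] (hB : S.HypUnbalanced)
    (hS : S.HypSmallerSpace) (hH : S.HypProjectionsH) (hU : S.IsSolution c U) (hP : Profile S c U V) {t : ℝ}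
    (ht : V t ∈ S.tubeH .minus (S.r .minus)) :
    S.excess U V t ≤ c * (S.C .minus ^ 2 / 2 + S.C .minus ^ 4) * (S.EH (V t) - S.a) := by
  obtain ⟨hpF, hpd⟩ := hH.PH_spec .minus _ ht
  set p := S.PH .minus (V t) with hp
  set C := S.C .minus with hC
  have hC1 : 1 < C := hB.one_lt_C .minus
  have hdist : ‖V t - p‖ ^ 2 ≤ C ^ 2 * (S.EH (V t) - S.a) := by
    have := hH.lower_est .minus _ ht
    rw [level_minus hB, inv_mul_le_iff₀ (by positivity)] at this
    exact this
  have hincl : ‖S.incl (V t - p)‖ ^ 2 ≤ ‖V t - p‖ ^ 2 :=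
    pow_le_pow_left₀ (norm_nonneg _) (hS.norm_incl_le _) 2
  -- Kinetic part: the segment has squared speed at most `C² (E - a)`. Potential part: the upper
  -- estimate gives `C²` times the same bound.
  set R := (C ^ 2 / 2 + C ^ 4) * (S.EH (V t) - S.a) with hR
  have he : 0 ≤ S.EH (V t) - S.a := by linarith [a_le_EH hB hS (V t)]
  have hR0 : 0 ≤ R := by positivity
  set D := connectDeriv (deriv U) (S.incl (V t - p)) t with hD
  set Z := connect V p (V t) t with hZ
  have hEp : S.EH p = S.a := by
    obtain ⟨w, hw⟩ := hB.nonempty .minus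
    have h1 := (hB.minimum w _ hpF).2
    rw [← coe_EH hB hS] at h1
    exact_mod_cast h1
  have hbound : ∀ s ≤ t, ‖D s‖ ^ 2 / 2 + S.EH (Z s) ≤ S.a + R := by
    intro s hs
    have h1 : S.EH (Z s) - S.a ≤ C ^ 2 * ‖V t - p‖ ^ 2 := by
      rw [hZ, connect_eq_of_le _ _ _ hs]
      exact EH_segment_le hB hH ht (le_max_left _ _) (max_le zero_le_one (by linarith))
    have h2 : ‖D s‖ ^ 2 ≤ ‖V t - p‖ ^ 2 := by
      rw [hD, connectDeriv, if_pos hs]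
      split_ifs
      · simp
      · exact hincl
    have h3 : C ^ 2 * ‖V t - p‖ ^ 2 ≤ C ^ 2 * (C ^ 2 * (S.EH (V t) - S.a)) :=
      mul_le_mul_of_nonneg_left hdist (sq_nonneg _)
    have h4 : R = C ^ 2 * (S.EH (V t) - S.a) / 2 + C ^ 2 * (C ^ 2 * (S.EH (V t) - S.a)) := by
      rw [hR]; ring
    linarith
  have hmeas : AEStronglyMeasurable (S.realDensity c D Z) := by
    have h1 := hP.stronglyMeasurable_connectDeriv (S.incl (V t - p)) t
    have h2 : Continuous fun s => S.EH (Z s) :=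
      hS.E_smooth.continuous.comp (connect_continuous hP.continuous p t)
    have h3 : Continuous fun s => Real.exp (c * s) := by fun_prop
    exact ((((h1.norm.measurable.pow_const 2).div_const 2).add h2.measurable).mul
      h3.measurable).aestronglyMeasurable
  obtain ⟨hint, hcmp⟩ := setIntegral_Iic_le_of_integral_le (a := S.a) (c := c) (t := t) (R := R)
    hU.c_pos (hP.integrable hB hS hU.energy_eq_zero) hmeas
    (fun s hs => by
      simp only [realDensity, hD, hZ, connectDeriv, connect_eq_of_lt _ _ _ hs,
        if_neg (not_le.mpr hs)])
    (fun s _ => by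
      refine mul_le_mul_of_nonneg_right ?_ (Real.exp_pos _).le
      have : 0 ≤ ‖D s‖ ^ 2 / 2 := by positivity
      linarith [a_le_EH hB hS (Z s)])
    (fun s hs => mul_le_mul_of_nonneg_right (hbound s hs) (Real.exp_pos _).le)
    (fun s hs => by
      rw [realDensity, hD, hZ, connectDeriv, connect_eq_of_le_sub_one _ _ _ hs, if_pos (by linarith),
        if_pos hs, hEp]
      simp)
    hR0
  have hdens : ∀ᵐ s, S.density c (fun s => S.incl (Z s)) s = (S.realDensity c D Z s : EReal) := by
    have hae : ∀ᵐ s : ℝ, s ∉ ({t, t - 1} : Set ℝ) :=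
      (Set.toFinite _).countable.ae_notMem _
    filter_upwards [hae] with s hs
    simp only [Set.mem_insert_iff, Set.mem_singleton_iff, not_or] at hs
    exact density_eq_realDensity hB hS rfl (hP.hasDerivAt_connect p hs.1 hs.2).deriv
  have hmin := hU.isMin _ (hP.connect_mem_X hU.mem_X (hB.r_pos .minus) hpF t)
  rw [energy_eq_integral hdens hint, hU.energy_eq_zero] at hmin
  have hmin' : 0 ≤ ∫ s, S.realDensity c D Z s := by exact_mod_cast hmin
  have h1 := hcmp ((hP.integral_eq_zero hB hS hU.energy_eq_zero).trans_le hmin')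
  have h2 := hP.setIntegral_Iic hB hS hU.c_pos hU.energy_eq_zero t
  have h3 := mul_le_mul_of_nonneg_left h1 hU.c_pos.le
  rw [h2] at h3
  have h4 : Real.exp (c * t) * S.excess U V t ≤ Real.exp (c * t) * (c * R) := by linarith
  have h5 := le_of_mul_le_mul_left h4 (Real.exp_pos _)
  rw [hR, ← mul_assoc] at h5
  exact h5

/-! ### Tubes, constants and the bound on the speed. -/

theorem tube_mono {s : Sgn} {ρ ρ' : ℝ} (h : ρ ≤ ρ') : S.tube s ρ ⊆ S.tube s ρ' :=
  fun _ hv => le_trans hv h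

theorem tubeH_mono {s : Sgn} {ρ ρ' : ℝ} (h : ρ ≤ ρ') : S.tubeH s ρ ⊆ S.tubeH s ρ' :=
  fun _ hv => le_trans hv h

theorem half_tubes_disjoint (hB : S.HypUnbalanced) {v : L}
    (hp : v ∈ S.tube .plus (S.r .plus / 2)) (hm : v ∈ S.tube .minus (S.r .minus / 2)) : False := by
  have h1 := hB.r_pos .plus
  have h2 := hB.r_pos .minus
  have : v ∈ S.tube .plus (S.r .plus) ∩ S.tube .minus (S.r .minus) :=
    ⟨tube_mono (by linarith) hp, tube_mono (by linarith) hm⟩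
  rwa [hB.disjoint] at this

theorem EH_nonneg_of_notMem_tube (hB : S.HypUnbalanced) (hS : S.HypSmallerSpace)
    (hL : S.HypLevelSets) {v : H} (hv : S.incl v ∉ S.tube .minus (S.r .minus / 2)) :
    0 ≤ S.EH v := by
  by_contra! hneg
  refine hv (hL.negative_levelset ?_)
  change S.E (S.incl v) < 0
  rw [← coe_EH hB hS]
  exact_mod_cast hneg

theorem rHatMinus_mem (hB : S.HypUnbalanced) : S.rHatMinus ∈ Set.Ioc 0 (S.r .minus) := by
  have h1 := hB.one_lt_C .minus
  have h2 := hB.r_pos .minus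
  exact ⟨div_pos h2 (by linarith), div_le_self h2.le (by linarith)⟩

/-- Gives room between the bound `-a` on the excess and the energy threshold below which `U(t)` is
in the `H`-tube. -/
theorem neg_a_lt_beta (hB : S.HypUnbalanced) (hH : S.HypProjectionsH) (hL : S.HypLevelSets) :
    -S.a < S.beta .minus S.rHatMinus := by
  have hC := hB.one_lt_C .minus
  have hβ := hH.beta_pos .minus _ (rHatMinus_mem hB)
  refine hL.neg_a_lt.trans_le ?_
  have hden : 1 ≤ S.C .minus ^ 2 * (S.C .minus + 1) :=
    one_le_mul_of_one_le_of_one_le (one_le_pow₀ hC.le) (by linarith)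
  calc S.EmaxMinus ≤ 1 / (S.C .minus ^ 2 * (S.C .minus + 1)) * S.beta .minus S.rHatMinus :=
        mul_le_mul_of_nonneg_left ((min_le_right _ _).trans (min_le_left _ _)) (by positivity)
    _ ≤ 1 * S.beta .minus S.rHatMinus :=
        mul_le_mul_of_nonneg_right (div_le_one_of_le₀ hden (by positivity)) hβ.le
    _ = _ := one_mul _

theorem CC_pos (hB : S.HypUnbalanced) (s : Sgn) : 0 < S.C s + S.CC s := by
  have := hB.one_lt_C s
  unfold CC
  positivity

/-- Expanding, `C + CC = C + C² / 2 + C³ + C⁴`, which exceeds `K` by `C + C³`. -/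
theorem gammaMinus_mul_le (hB : S.HypUnbalanced) :
    S.gammaMinus * (S.C .minus ^ 2 / 2 + S.C .minus ^ 4) ≤ 1 := by
  have hC := hB.one_lt_C .minus
  have h1 := CC_pos hB .minus
  rw [gammaMinus, one_div, inv_mul_le_iff₀ h1, mul_one, CC]
  have : 0 ≤ S.C .minus ^ 3 := by positivity
  nlinarith

/-- The travelling speed is bounded in terms of the depth of the well and
the distance between the tubes. -/
theorem IsSolution.speed_mul_d0_le (hB : S.HypUnbalanced) (hS : S.HypSmallerSpace)
    (hL : S.HypLevelSets) (hU : S.IsSolution c U) (hP : Profile S c U V) :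
    c * S.d0 ≤ Real.sqrt (-2 * S.a) := by
  obtain ⟨-, T, hT1, hTp, hTm⟩ := hU.mem_X
  have hc := hU.c_pos
  have hUc : Continuous U := continuous_iff_continuousAt.mpr fun s => (hP.hasDerivAt s).continuousAt
  set Λ : Set ℝ := {s | U s ∈ S.tube .minus (S.r .minus / 2)} with hΛ
  have hΛclosed : IsClosed Λ :=
    isClosed_le ((Metric.continuous_infDist_pt _).comp hUc) continuous_const
  have hΛT : ∀ s ∈ Λ, s ≤ T := fun s hs => by
    by_contra! h
    exact half_tubes_disjoint hB (hTp s h.le) hs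
  have hΛbdd : BddAbove Λ := ⟨T, hΛT⟩
  -- The last time in the half tube of `F^-`: it is one endpoint of the crossing, and the potential
  -- is nonnegative from then on.
  have hmem : sSup Λ ∈ Λ := hΛclosed.csSup_mem ⟨-T, hTm (-T) le_rfl⟩ hΛbdd
  set t₁ := sSup Λ with ht₁
  have ht₁T : t₁ ≤ T := hΛT _ hmem
  have hpos : ∀ s, t₁ < s → 0 ≤ S.EH (V s) := fun s hs => by
    refine EH_nonneg_of_notMem_tube hB hS hL fun h => ?_
    rw [hP.incl_eq] at h
    exact absurd (le_csSup hΛbdd h) (not_le.mpr hs)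
  have hEc : Continuous fun s => S.EH (V s) := hS.E_smooth.continuous.comp hP.continuous
  have hpos' : ∀ s, t₁ ≤ s → 0 ≤ S.EH (V s) := by
    have h1 : Set.Ioi t₁ ⊆ {s | 0 ≤ S.EH (V s)} := hpos
    have h2 := closure_minimal h1 (isClosed_le continuous_const hEc)
    rw [closure_Ioi] at h2
    exact fun s hs => h2 hs
  have hend : S.excess U V T ≤ -S.a :=
    hP.excess_le_of_nonneg hB hS hc hU.energy_eq_zero fun s hs => hpos s (ht₁T.trans_lt hs)
  have hstart := hP.excess_nonneg hB hS hc hU.energy_eq_zero t₁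
  have hd0 : S.d0 ≤ ‖U T - U t₁‖ := by
    rw [← dist_eq_norm]
    refine csInf_le ⟨0, ?_⟩ (Set.mem_image2_of_mem (hTp T le_rfl) hmem)
    rintro _ ⟨x, _, y, _, rfl⟩
    exact dist_nonneg
  set σ := Real.sqrt (-2 * S.a) with hσ
  have ha := hB.a_neg
  have hσ0 : 0 < σ := Real.sqrt_pos.mpr (by linarith)
  have hσ2 : σ ^ 2 = -2 * S.a := Real.sq_sqrt (by linarith)
  -- The weight that balances the two Young terms: the energy term, of size `-2a l e^{ct₁}`, and
  -- `l⁻¹ e^{-ct₁}` both become `σ`.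
  set l := σ⁻¹ * Real.exp (-(c * t₁)) with hl
  have hl0 : 0 < l := by positivity
  -- `e^{ct} (E(U) - |U'|^2 / 2)`
  have hΦ : ∀ x, HasDerivAt (fun t => Real.exp (c * t) * (S.excess U V t + S.a))
      (c * S.realDensity c (deriv U) V x) x := fun x => by
    have h1 := (((hasDerivAt_id x).const_mul c).exp).mul ((hP.hamiltonian x).add_const S.a)
    refine h1.congr_deriv ?_
    simp only [realDensity, id]
    ring
  have hexp : ∀ x, HasDerivAt (fun t => Real.exp (-(c * t)))
      (Real.exp (-(c * x)) * -(c * 1)) x := fun x =>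
    ((hasDerivAt_id x).const_mul c).neg.exp
  have hmain := norm_sub_le_sub_of_norm_deriv_le hP.hasDerivAt
    (fun x => ((((hΦ x).const_mul (2 * l)).sub ((hexp x).const_mul l⁻¹)).div_const c).const_mul
      (1 / 2)) ht₁T (fun x hx _ => by
      have h1 := le_half_weighted_sq_add_inv ‖deriv U x‖ (mul_pos hl0 (Real.exp_pos (c * x)))
      rw [mul_inv, ← Real.exp_neg] at h1
      have h2 : 0 ≤ l * Real.exp (c * x) * S.EH (V x) :=
        mul_nonneg (by positivity) (hpos' x hx)
      have h3 : 1 / 2 * ((2 * l * (c * S.realDensity c (deriv U) V x) -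
          l⁻¹ * (Real.exp (-(c * x)) * -(c * 1))) / c) =
          1 / 2 * (l * Real.exp (c * x) * ‖deriv U x‖ ^ 2 + l⁻¹ * Real.exp (-(c * x))) +
          l * Real.exp (c * x) * S.EH (V x) := by
        rw [realDensity]; field_simp; ring
      rw [h3]
      linarith)
  simp only [Pi.sub_apply] at hmain
  have hT0 : 2 * l * (Real.exp (c * T) * (S.excess U V T + S.a)) ≤ 0 :=
    mul_nonpos_of_nonneg_of_nonpos (by positivity)
      (mul_nonpos_of_nonneg_of_nonpos (Real.exp_pos _).le (by linarith))
  have hlexp : l * Real.exp (c * t₁) = σ⁻¹ := by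
    rw [hl, mul_assoc, ← Real.exp_add, neg_add_cancel, Real.exp_zero, mul_one]
  have hlinv : l⁻¹ * Real.exp (-(c * t₁)) = σ := by
    rw [hl, mul_inv, inv_inv, mul_assoc, inv_mul_cancel₀ (Real.exp_pos _).ne', mul_one]
  have ht0 : -(2 * l * (Real.exp (c * t₁) * (S.excess U V t₁ + S.a))) ≤ σ := by
    have h1 : 2 * l * (Real.exp (c * t₁) * (S.excess U V t₁ + S.a)) =
        2 * (σ⁻¹ * (S.excess U V t₁ + S.a)) := by rw [← hlexp]; ring
    have h2 : σ⁻¹ * S.a ≤ σ⁻¹ * (S.excess U V t₁ + S.a) :=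
      mul_le_mul_of_nonneg_left (by linarith) (by positivity)
    have h3 : 2 * (σ⁻¹ * S.a) = -σ := by
      field_simp
      linarith
    rw [h1]
    linarith
  have hTe : 0 ≤ l⁻¹ * Real.exp (-(c * T)) := by positivity
  have hfin : S.d0 ≤ σ / c := by
    refine hd0.trans (hmain.trans ?_)
    rw [← mul_sub, ← sub_div, ← mul_div_assoc]
    refine div_le_div_of_nonneg_right ?_ hc.le
    linarith
  rwa [le_div_iff₀ hc, mul_comm] at hfin

theorem d0_nonneg (S : Setting L H Ht) : 0 ≤ S.d0 := by
  refine Real.sInf_nonneg ?_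
  rintro _ ⟨x, _, y, _, rfl⟩
  exact dist_nonneg

theorem IsSolution.speed_lt (hB : S.HypUnbalanced) (hS : S.HypSmallerSpace)
    (hL : S.HypLevelSets) (hC : S.HypConvergence) (hU : S.IsSolution c U) (hP : Profile S c U V) :
    c < S.gammaMinus := by
  have h1 := hU.speed_mul_d0_le hB hS hL hP
  have hγ : 0 < S.gammaMinus := div_pos one_pos (CC_pos hB .minus)
  have h2 : Real.sqrt (-2 * S.a) < S.d0 * S.gammaMinus := by
    have h3 : -S.a < (S.d0 * S.gammaMinus) ^ 2 / 2 := hC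
    -- The depth assumption itself excludes `d₀ = 0`, because `-a > 0`.
    have hne : 0 < S.d0 * S.gammaMinus := by
      refine lt_of_le_of_ne (mul_nonneg (d0_nonneg S) hγ.le) fun h => ?_
      rw [← h] at h3
      linarith [hB.a_neg]
    rw [Real.sqrt_lt' hne]
    linarith
  have h3 : S.d0 * c < S.d0 * S.gammaMinus := by linarith
  exact lt_of_mul_lt_mul_left h3 (d0_nonneg S)

end

end Setting

end TravelingWave

end

/-! ### Conclusion: decay of the excess and the limit in the well. -/

theorem mainTheorem6 {L H Ht : Type*}
    [NormedAddCommGroup L] [InnerProductSpace ℝ L] [CompleteSpace L]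
    [NormedAddCommGroup H] [InnerProductSpace ℝ H] [CompleteSpace H]
    [NormedAddCommGroup Ht] [InnerProductSpace ℝ Ht]
    (S : TravelingWave.Setting L H Ht)
    (h_unbalanced : S.HypUnbalanced)
    (h_smaller_space : S.HypSmallerSpace)
    (h_compactness : S.HypCompactness)
    (h_projections_inverse : S.HypProjectionsInverse)
    (h_projections_H : S.HypProjectionsH)
    (h_regularity : S.HypRegularity)
    (h_levelsets : S.HypLevelSets)
    (h_convergence : S.HypConvergence)
    (c : ℝ) (U : ℝ → L) (hU : S.IsSolution c U) :
    c < S.gammaMinus ∧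
      ∃ v ∈ S.F TravelingWave.Sgn.minus, ∃ M : ℝ, 0 < M ∧
        ∀ t : ℝ, ‖U t - v‖ ≤ M * Real.exp ((S.gammaMinus - c) * t) := by
  obtain ⟨V, hP⟩ := hU.exists_profile h_smaller_space
  have hspeed := hU.speed_lt h_unbalanced h_smaller_space h_levelsets h_convergence hP
  refine ⟨hspeed, ?_⟩
  have hc := hU.c_pos
  have hC := h_unbalanced.one_lt_C .minus
  have hr := h_unbalanced.r_pos .minus
  obtain ⟨-, T, -, hTp, hTm⟩ := hU.mem_X
  have htube : ∀ t ≤ -T, U t ∈ S.tube .minus (S.r .minus) := fun t ht =>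
    TravelingWave.Setting.tube_mono (by linarith) (hTm t ht)
  have hg : ∀ t, HasDerivAt (S.excess U V) (c * ‖deriv U t‖ ^ 2) t := hP.hamiltonian
  have hg0 : ∀ t, 0 ≤ S.excess U V t :=
    hP.excess_nonneg h_unbalanced h_smaller_space hc hU.energy_eq_zero
  -- By monotonicity it suffices to bound `g` at a time after which `U` stays in the half tube of
  -- `F^+`, where the potential is nonnegative.
  have hgA : ∀ t, S.excess U V t ≤ -S.a := fun t => by
    refine (monotone_of_dissipation hc hg (le_max_left t T)).trans ?_
    refine hP.excess_le_of_nonneg h_unbalanced h_smaller_space hc hU.energy_eq_zero fun s hs => ?_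
    refine TravelingWave.Setting.EH_nonneg_of_notMem_tube h_unbalanced h_smaller_space
      h_levelsets fun h => ?_
    rw [hP.incl_eq] at h
    exact TravelingWave.Setting.half_tubes_disjoint h_unbalanced
      (hTp s ((le_max_right t T).trans hs.le)) h
  have hsum : ∀ t, S.excess U V t + ‖deriv U t‖ ^ 2 / 2 = S.EH (V t) - S.a := fun t => by
    rw [TravelingWave.Setting.excess]; ring
  have hrhat := TravelingWave.Setting.rHatMinus_mem h_unbalanced
  obtain ⟨hsmall, t₁, hdecay⟩ := excess_decay (T := -T) hc
    (K := S.C .minus ^ 2 / 2 + S.C .minus ^ 4) (by positivity)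
    (TravelingWave.Setting.gammaMinus_mul_le h_unbalanced) hspeed
    (TravelingWave.Setting.neg_a_lt_beta h_unbalanced h_projections_H h_levelsets) hg hg0 hgA
    (fun t ht hle => by
      rw [hsum] at hle ⊢
      refine hU.excess_le_of_mem_tubeH h_unbalanced h_smaller_space h_projections_H hP ?_
      obtain ⟨w, hw, hwU⟩ := h_projections_H.local_bound .minus _ hrhat _ (htube t ht) (by
        rw [← hP.incl_eq, ← TravelingWave.Setting.coe_EH h_unbalanced h_smaller_space,
          TravelingWave.Setting.level_minus h_unbalanced]
        exact_mod_cast (by linarith))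
      rw [h_smaller_space.incl_injective ((hP.incl_eq t).trans hwU.symm)]
      exact TravelingWave.Setting.tubeH_mono hrhat.2 hw)
  obtain ⟨v, hv, hM⟩ := exists_exponential_limit hc hspeed hP.hasDerivAt hg hg0 hgA hdecay
  refine ⟨v, ?_, hM⟩
  rw [(h_unbalanced.closed .minus).mem_iff_infDist_zero (h_unbalanced.nonempty .minus)]
  refine le_antisymm (le_of_forall_pos_le_add fun ε hε => ?_) Metric.infDist_nonneg
  have hη : 0 < (S.C .minus)⁻¹ * (ε / 2) ^ 2 / 2 := by positivity
  obtain ⟨t₂, ht₂⟩ := hsmall _ hη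
  obtain ⟨t₃, ht₃⟩ := eventually_atBot.mp
    ((Metric.tendsto_nhds.mp hv) (ε / 2) (by linarith))
  -- `E(U) - a` is the excess plus the kinetic energy, so coercivity needs a time at which the speed
  -- is small too.
  obtain ⟨t, ht, hsp⟩ := exists_small_speed hc hg hg0 hη (min (-T) (min t₂ t₃))
  have h1 := ht₂ t (ht.trans ((min_le_right _ _).trans (min_le_left _ _)))
  have h2 := ht₃ t (ht.trans ((min_le_right _ _).trans (min_le_right _ _)))
  have h3 := h_unbalanced.coercive .minus _ (htube t (ht.trans (min_le_left _ _)))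
  rw [← hP.incl_eq, ← TravelingWave.Setting.coe_EH h_unbalanced h_smaller_space,
    TravelingWave.Setting.level_minus h_unbalanced, hP.incl_eq, ← EReal.coe_sub,
    EReal.coe_le_coe_iff, ← hsum] at h3
  have h4 : (S.C .minus)⁻¹ * Metric.infDist (U t) (S.F .minus) ^ 2 <
      (S.C .minus)⁻¹ * (ε / 2) ^ 2 := by
    have : 0 ≤ ‖deriv U t‖ ^ 2 := by positivity
    linarith
  have h5 := lt_of_pow_lt_pow_left₀ 2 (by linarith) (lt_of_mul_lt_mul_left h4 (by positivity))
  have h6 := Metric.infDist_le_infDist_add_dist (s := S.F .minus) (x := v) (y := U t)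
  rw [dist_comm] at h6
  linarith
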